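/- **Notation.** Let $\mathcal O$ be a commutative ring with $1$, $e\in\{0,2,3,4,\dots\}$, $I=\mathbb Z/e\mathbb Z$, with arrows $i\to j$ iff $j=i-1$. Put $a_{ij}=2$ if $i=j$, $a_{ij}=-2$ if $i\ne j$ and both $i\to j$ and $j\to i$, $a_{ij}=-1$ if exactly one of these arrows exists, and $a_{ij}=0$ otherwise. Let $Q_+=\bigoplus_{i\in I}\mathbb Z_{\ge0}\alpha_i$; for $\alpha=\sum a_i\alpha_i\in Q_+$ put $\operatorname{ht}(\alpha)=\sum a_i$ and $\alpha'=\sum a_i\alpha_{-i}$. Fix $\alpha$, let $d=\operatorname{ht}(\alpha)$ and $I^\alpha=\{\boldsymbol i\in I^d\mid \alpha_{i_1}+\dots+\alpha_{i_d}=\alpha\}$. **KLR algebra.** $R_\alpha=R_\alpha(\mathcal O)$ is the unital $\mathcal O$-algebra with generators $e(\boldsymbol i)$ $(\boldsymbol i\in I^\alpha)$, $y_1,\dots,y_d$, $\psi_1,\dots,\psi_{d-1}$ and relations $e(\boldsymbol i)e(\boldsymbol j)=\delta_{\boldsymbol i\boldsymbol j}e(\boldsymbol i)$; $\sum_{\boldsymbol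 i} e(\boldsymbol i)=1$; $y_re(\boldsymbol i)=e(\boldsymbol i)y_r$; $\psi_re(\boldsymbol i)=e(s_r\boldsymbol i)\psi_r$; $y_ry_s=y_sy_r$; $\psi_ry_s=y_s\psi_r$ for $s\ne r,r+1$; $\psi_r\psi_s=\psi_s\psi_r$ for $|r-s|>1$; $\psi_ry_{r+1}e(\boldsymbol i)=(y_r\psi_r+\delta_{i_r,i_{r+1}})e(\boldsymbol i)$; $y_{r+1}\psi_re(\boldsymbol i)=(\psi_ry_r+\delta_{i_r,i_{r+1}})e(\boldsymbol i)$; $\psi_r^2e(\boldsymbol i)=Q\,e(\boldsymbol i)$, where $Q=0$ if $i_r=i_{r+1}$, and otherwise $Q=(y_{r+1}-y_r)(y_r-y_{r+1})$, $y_{r+1}-y_r$, $y_r-y_{r+1}$ or $1$ according as there are arrows in both directions, only $i_r\to i_{r+1}$, only $i_{r+1}\to i_r$, or none; $\psi_r\psi_{r+1}\psi_re(\boldsymbol i)=(\psi_{r+1}\psi_r\psi_{r+1}+B)e(\boldsymbol i)$, where $B=0$ unless $i_{r+2}=i_r$, in which case $B=-2y_{r+1}+y_r+y_{r+2}$, $1$,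 $-1$ or $0$ according as there are arrows in both directions, only $i_r\to i_{r+1}$, only $i_{r+1}\to i_r$, or none. It is graded by $\deg e(\boldsymbol i)=0$, $\deg y_r=2$, $\deg\psi_re(\boldsymbol i)=-a_{i_r,i_{r+1}}$. The sign isomorphism is the isomorphism of graded algebras $\mathtt{sgn}:R_\alpha\to R_{\alpha'}$, $e(\boldsymbol i)\mapsto e(-\boldsymbol i)$, $y_r\mapsto-y_r$, $\psi_r\mapsto-\psi_r$. For a graded $R_{\alpha'}$-module $M$, $M^{\mathtt{sgn}}$ is the graded $\mathcal O$-module $M$ on which $a\in R_\alpha$ acts as $\mathtt{sgn}(a)$. Fix a reduced decomposition $w=s_{r_1}\cdots s_{r_m}$ of every permutation and let $\psi_w=\psi_{r_1}\cdots\psi_{r_m}$. **Tableaux.** Fix $l\ge1$ and $\kappa=(k_1,\dots,k_l)\in I^l$. The node $(a,b,m)$ (row $a$, column $b$, component $m$) has residue $k_m+b-a\in I$. Let $\mathscr P^\kappa_\alpha$ be the set of $l$-multipartitions $\mu$ (identified with their diagrams) with $\sum_{A\in\mu}\alpha_{\operatorname{res}A}=\alpha$. Put $\kappa'=(-k_l,\dots,-k_1)$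 and $\mu'=(\mu^{(l)\prime},\dots,\mu^{(1)\prime})\in\mathscr P^{\kappa'}_{\alpha'}$, where $\mu^{(m)\prime}$ is the conjugate partition. A $\mu$-tableau is a bijection from the nodes of $\mu$ to $\{1,\dots,d\}$; $\boldsymbol i(T)$ is its residue sequence. $T^\mu$ is filled along successive rows, from the top row of component $1$ to the bottom row of component $l$; $T_\mu$ is filled down successive columns, from left to right within a component, from component $l$ to component $1$. For a $\mu$-tableau $T$ let $w^TT^\mu=T=w_TT_\mu$, $\psi^T=\psi_{w^T}$, $\psi_T=\psi_{w_T}$. For a standard tableau $T$ with largest entry $d$ in $A$, $i=\operatorname{res}A$: $\deg T=d_A(\mu)+\deg T_{<d}$ and $\operatorname{codeg}T=d^A(\mu\setminus\{A\})+\operatorname{codeg}T_{<d}$ (both $0$ for the empty tableau), where $d_A(\nu)$ (resp. $d^A(\nu)$) is the number of addable minus the number of removable $i$-nodes of $\nu$ strictly below (resp. above) $A$; component $m$ is above component $m+1$. **Garnir elements.** A node $A=(a,b,m)\in\mu$ is a row Garnir node if $(a+1,b,m)\in\mu$. Its belt is $\{(a,c,m)\in\mu\mid c\ge b\}\cup\{(a+1,c,m)\in\mu\mid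 c\le b\}$; $G^A$ agrees with $T^\mu$ outside the belt, and in the belt the same entries increase from left to right first along row $a+1$, then along row $a$. If $e>0$, a brick is a set of $e$ successive nodes of the belt in one row whose leftmost node has residue $\operatorname{res}A$ (no bricks if $e=0$). Let $k$ be the number of bricks, $f$ the number of those in row $a$, and $n$ the smallest entry of $G^A$ in a brick; the bricks are filled in $G^A$ by $k$ consecutive blocks of $e$ numbers, starting at $n$. Let $w_r=\prod_{x=n+re-e}^{n+re-1}(x,x+e)$ for $1\le r<k$; these generate a group $\cong\mathfrak S_k$. $T^A$ is the tableau obtained from $G^A$ by the brick permutation that puts the bricks of row $a$ before those of row $a+1$, keeping the order within each row. Let $\boldsymbol i^A=\boldsymbol i(G^A)$, $\tau_r=(\psi_{w_r}e(\boldsymbol i^A)+1)e(\boldsymbol i^A)$ and $g^A=\sum_u\tau_u\psi^{T^A}$, the sum over the minimal length left coset representatives $u$ of $\mathfrak S_f\times\mathfrak S_{k-f}$ in $\mathfrak S_k$, where $\tau_u=\tau_{r_1}\cdots\tau_{r_m}$ for a reduced decomposition of $u$. Column Garnir nodes $A$ (those with $(a,b+1,m)\in\mu$) and $g_A=\sum_u\tau^u\psi_{T_A}$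 are defined in the same way with belt $\{(c,b,m)\in\mu\mid c\ge a\}\cup\{(c,b+1,m)\in\mu\mid c\le a\}$, $T_\mu$ in place of $T^\mu$, columns $b,b+1$ (read from top to bottom) in place of rows $a,a+1$, the topmost node of a brick having residue $\operatorname{res}A$, and $\tau^r=((-1)^e\psi_{w_r}e(\boldsymbol i_A)+1)e(\boldsymbol i_A)$, $\boldsymbol i_A=\boldsymbol i(G_A)$. **Specht modules.** For $\mu\in\mathscr P^\kappa_\alpha$, the row Specht module $S^\mu=S^\mu(\mathcal O)$ is the graded $R_\alpha$-module generated by $z^\mu$ of degree $\deg T^\mu$ subject to $e(\boldsymbol j)z^\mu=\delta_{\boldsymbol j,\boldsymbol i(T^\mu)}z^\mu$ $(\boldsymbol j\in I^\alpha)$; $y_rz^\mu=0$ for all $r$; $\psi_rz^\mu=0$ whenever $r+1$ lies in $T^\mu$ in the same row as $r$ (and to its right); $g^Az^\mu=0$ for all row Garnir nodes $A$. The column Specht module $S_\mu=S_\mu(\mathcal O)$ is generated by $z_\mu$ of degree $\operatorname{codeg}T_\mu$ subject to $e(\boldsymbol j)z_\mu=\delta_{\boldsymbol j,\boldsymbol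 i(T_\mu)}z_\mu$; $y_rz_\mu=0$ for all $r$; $\psi_rz_\mu=0$ whenever $r+1$ lies in $T_\mu$ in the same column as $r$ (and below it); $g_Az_\mu=0$ for all column Garnir nodes $A$. The modules $S^{\mu'}$ and $S_{\mu'}$ over $R_{\alpha'}$ are formed with respect to $\kappa'$. **Theorem.** Let $\alpha\in Q_+$ with $d=\operatorname{ht}(\alpha)$, and let $\mu\in\mathscr P^\kappa_\alpha$. Then $$S^\mu\cong(S_{\mu'})^{\mathtt{sgn}}\quad\text{and}\quad S_\mu\cong(S^{\mu'})^{\mathtt{sgn}}$$ as graded $R_\alpha(\mathcal O)$-modules (by isomorphisms of degree $0$). -/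

import Mathlib

open Finset

noncomputable section

namespace KLR

/-! ### Lie theoretic notation -/

/-- The quiver on `I = ℤ/eℤ`: there is an arrow `i → j` iff `j = i - 1`. -/
def Arrow {e : ℕ} (i j : ZMod e) : Prop := j = i - 1

open Classical in
/-- The Cartan matrix `(a_{i,j})`. -/
def cartan {e : ℕ} (i j : ZMod e) : ℤ :=
  if i = j then 2
  else if Arrow i j ∧ Arrow j i then -2
  else if Arrow i j ∨ Arrow j i then -1
  else 0

/-- The positive part `Q₊` of the root lattice: `α = ∑ aᵢ αᵢ` with `aᵢ ∈ ℕ`. -/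
abbrev QPlus (e : ℕ) := ZMod e →₀ ℕ

/-- The height of `α ∈ Q₊`, the sum of the coefficients. -/
def ht {e : ℕ} (α : QPlus e) : ℕ := α.degree

/-- `α' = ∑ aᵢ α₋ᵢ` for `α = ∑ aᵢ αᵢ`. -/
def QPlus.neg {e : ℕ} (α : QPlus e) : QPlus e := α.mapDomain (fun i => -i)

/-- The weight `|i| = ∑ᵣ α_{iᵣ}` of a sequence `i ∈ I^d`. -/
def weight {e d : ℕ} (i : Fin d → ZMod e) : QPlus e := ∑ r, Finsupp.single (i r) 1

/-- `I^α`, the set of sequences of weight `α`, where `d` is the height of `α`. -/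
def Seq {e : ℕ} (d : ℕ) (α : QPlus e) := {i : Fin d → ZMod e // weight i = α}

theorem Seq.mem_support {e d : ℕ} {α : QPlus e} (i : Seq d α) (r : Fin d) :
    i.1 r ∈ α.support := by
  obtain ⟨i, rfl⟩ := i
  rw [Finsupp.mem_support_iff]
  unfold weight
  rw [Finsupp.finsetSum_apply]
  intro h
  have := (Finset.sum_eq_zero_iff.1 h) r (Finset.mem_univ r)
  simp at this

instance {e d : ℕ} (α : QPlus e) : Finite (Seq d α) :=
  Finite.of_injective
    (fun (i : Seq d α) (r : Fin d) => (⟨i.1 r, i.mem_support r⟩ : {x // x ∈ α.support}))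
    (fun _ _ h => Subtype.ext (funext fun r => congrArg Subtype.val (congrFun h r)))

instance {e d : ℕ} (α : QPlus e) : Fintype (Seq d α) := Fintype.ofFinite _

/-! ### The symmetric group

The letters are `0, …, d - 1`, and `r : Fin (d - 1)` stands for the pair of neighbours
`r, r + 1`. -/

/-- The first of the two neighbouring letters `r, r + 1`. -/
def lo {d : ℕ} (r : Fin (d - 1)) : Fin d := ⟨r, by omega⟩

/-- The second of the two neighbouring letters `r, r + 1`. -/
def hi {d : ℕ} (r : Fin (d - 1)) : Fin d := ⟨r + 1, by omega⟩

/-- The simple transposition `s_r = (r, r + 1)`. -/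
def simple {d : ℕ} (r : Fin (d - 1)) : Equiv.Perm (Fin d) := Equiv.swap (lo r) (hi r)

/-- The length of `w`: the least length of a word in simple transpositions with product `w`. -/
def length {d : ℕ} (w : Equiv.Perm (Fin d)) : ℕ :=
  sInf {n | ∃ L : List (Fin (d - 1)), L.length = n ∧ (L.map simple).prod = w}

/-- `L` is a reduced decomposition of `w`. -/
def IsReduced {d : ℕ} (L : List (Fin (d - 1))) (w : Equiv.Perm (Fin d)) : Prop :=
  (L.map simple).prod = w ∧ L.length = length w

/-- A choice of a preferred reduced decomposition of every permutation. -/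
structure Preferred where
  word : ∀ {n : ℕ}, Equiv.Perm (Fin n) → List (Fin (n - 1))
  isReduced : ∀ {n : ℕ} (w : Equiv.Perm (Fin n)), IsReduced (word w) w

theorem exists_word {d : ℕ} (w : Equiv.Perm (Fin d)) :
    ∃ L : List (Fin (d - 1)), (L.map simple).prod = w := by
  cases d with
  | zero => exact ⟨[], Subsingleton.elim _ _⟩
  | succ n =>
    have hw : w ∈ Submonoid.closure
        (Set.range fun i : Fin n => Equiv.swap i.castSucc i.succ) := by
      rw [Equiv.Perm.mclosure_swap_castSucc_succ]; trivial
    induction hw using Submonoid.closure_induction with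
    | mem x hx =>
      obtain ⟨i, rfl⟩ := hx
      exact ⟨[i], by simp [simple, lo, hi]; rfl⟩
    | one => exact ⟨[], rfl⟩
    | mul x y _ _ hx hy =>
      obtain ⟨L, rfl⟩ := hx
      obtain ⟨M, rfl⟩ := hy
      exact ⟨L ++ M, by simp⟩

theorem exists_reduced {d : ℕ} (w : Equiv.Perm (Fin d)) :
    ∃ L : List (Fin (d - 1)), IsReduced L w := by
  obtain ⟨L, hL⟩ := exists_word w
  obtain ⟨M, hM, hw⟩ := Nat.sInf_mem
    (s := {n | ∃ L : List (Fin (d - 1)), L.length = n ∧ (L.map simple).prod = w})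
    ⟨L.length, L, rfl, hL⟩
  exact ⟨M, hw, hM⟩

instance : Nonempty Preferred :=
  ⟨⟨fun w => (exists_reduced w).choose, fun w => (exists_reduced w).choose_spec⟩⟩

/-- The parabolic subgroup `S_f × S_{k-f}` of `S_k`. -/
def parabolic (k f : ℕ) : Subgroup (Equiv.Perm (Fin k)) :=
  Subgroup.closure {s | ∃ r : Fin (k - 1), (r : ℕ) + 1 ≠ f ∧ s = simple r}

open Classical in
/-- The minimal length left coset representatives of `S_f × S_{k-f}` in `S_k`. -/
def cosetReps (k f : ℕ) : Finset (Equiv.Perm (Fin k)) :=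
  Finset.univ.filter fun u => ∀ v ∈ parabolic k f, length u ≤ length (u * v)

/-! ### KLR algebras -/

/-- `s_r · i`. -/
def Seq.swap {e d : ℕ} {α : QPlus e} (r : Fin (d - 1)) (i : Seq d α) : Seq d α :=
  ⟨fun t => i.1 (simple r t), (Equiv.sum_comp (simple r) fun t => Finsupp.single (i.1 t) 1).trans i.2⟩

/-- The generators `e(i)`, `y_r`, `ψ_r` of the KLR algebra. -/
inductive Gen {e : ℕ} (d : ℕ) (α : QPlus e) : Type
  | e (i : Seq d α) : Gen d α
  | y (r : Fin d) : Gen d α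
  | psi (r : Fin (d - 1)) : Gen d α

section Relations

variable (O : Type*) [CommRing O] {e d : ℕ} {α : QPlus e}

/-- The free generator `e(i)`. -/
def fe (i : Seq d α) : FreeAlgebra O (Gen d α) := FreeAlgebra.ι O (Gen.e i)
/-- The free generator `y_r`. -/
def fy (r : Fin d) : FreeAlgebra O (Gen d α) := FreeAlgebra.ι O (Gen.y r)
/-- The free generator `ψ_r`. -/
def fpsi (r : Fin (d - 1)) : FreeAlgebra O (Gen d α) := FreeAlgebra.ι O (Gen.psi r)

open Classical in
/-- The Kronecker delta `δ_{i_r, i_{r+1}}`. -/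
def delta (r : Fin (d - 1)) (i : Seq d α) : FreeAlgebra O (Gen d α) :=
  if i.1 (lo r) = i.1 (hi r) then 1 else 0

open Classical in
/-- The element `Q` with `ψ_r² e(i) = Q e(i)`. -/
def quad (r : Fin (d - 1)) (i : Seq d α) : FreeAlgebra O (Gen d α) :=
  if i.1 (lo r) = i.1 (hi r) then 0
  else if Arrow (i.1 (lo r)) (i.1 (hi r)) ∧ Arrow (i.1 (hi r)) (i.1 (lo r)) then
    (fy O (hi r) - fy O (lo r)) * (fy O (lo r) - fy O (hi r))
  else if Arrow (i.1 (lo r)) (i.1 (hi r)) then fy O (hi r) - fy O (lo r)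
  else if Arrow (i.1 (hi r)) (i.1 (lo r)) then fy O (lo r) - fy O (hi r)
  else 1

open Classical in
/-- The error term `B`, with `s = r + 1`, in the braid relation
`ψ_r ψ_s ψ_r e(i) = (ψ_s ψ_r ψ_s + B) e(i)`. -/
def braid (r s : Fin (d - 1)) (i : Seq d α) : FreeAlgebra O (Gen d α) :=
  if i.1 (hi s) = i.1 (lo r) then
    if Arrow (i.1 (lo r)) (i.1 (lo s)) ∧ Arrow (i.1 (lo s)) (i.1 (lo r)) then
      fy O (lo r) + fy O (hi s) - 2 • fy O (lo s)
    else if Arrow (i.1 (lo r)) (i.1 (lo s)) then 1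
    else if Arrow (i.1 (lo s)) (i.1 (lo r)) then -1
    else 0
  else 0

open Classical in
/-- The defining relations of the KLR algebra. -/
inductive Rel : FreeAlgebra O (Gen d α) → FreeAlgebra O (Gen d α) → Prop
  | idem (i j : Seq d α) : Rel (fe O i * fe O j) (if i = j then fe O i else 0)
  | unit : Rel (∑ i : Seq d α, fe O i) 1
  | y_e (r : Fin d) (i : Seq d α) : Rel (fy O r * fe O i) (fe O i * fy O r)
  | psi_e (r : Fin (d - 1)) (i : Seq d α) :
      Rel (fpsi O r * fe O i) (fe O (i.swap r) * fpsi O r)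
  | y_y (r s : Fin d) : Rel (fy O r * fy O s) (fy O s * fy O r)
  | psi_y (r : Fin (d - 1)) (s : Fin d) (h₁ : s ≠ lo r) (h₂ : s ≠ hi r) :
      Rel (fpsi O r * fy O s) (fy O s * fpsi O r)
  | psi_psi (r s : Fin (d - 1)) (h : (r : ℕ) + 1 < s ∨ (s : ℕ) + 1 < r) :
      Rel (fpsi O r * fpsi O s) (fpsi O s * fpsi O r)
  | psi_y_hi (r : Fin (d - 1)) (i : Seq d α) :
      Rel (fpsi O r * fy O (hi r) * fe O i) ((fy O (lo r) * fpsi O r + delta O r i) * fe O i)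
  | y_hi_psi (r : Fin (d - 1)) (i : Seq d α) :
      Rel (fy O (hi r) * fpsi O r * fe O i) ((fpsi O r * fy O (lo r) + delta O r i) * fe O i)
  | psi_sq (r : Fin (d - 1)) (i : Seq d α) :
      Rel (fpsi O r * fpsi O r * fe O i) (quad O r i * fe O i)
  | psi_braid (r s : Fin (d - 1)) (h : (s : ℕ) = r + 1) (i : Seq d α) :
      Rel (fpsi O r * fpsi O s * fpsi O r * fe O i)
        ((fpsi O s * fpsi O r * fpsi O s + braid O r s i) * fe O i)

end Relations

/-- The (affine) KLR algebra `R_α(O)`, where `d` is the height of `α`. -/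
def Alg (O : Type*) [CommRing O] {e : ℕ} (d : ℕ) (α : QPlus e) := RingQuot (Rel O (d := d) (α := α))

section Algebra

variable (O : Type*) [CommRing O] {e d : ℕ} {α : QPlus e}

instance : Ring (Alg O d α) := inferInstanceAs (Ring (RingQuot _))
instance : Algebra O (Alg O d α) := inferInstanceAs (Algebra O (RingQuot _))

/-- The quotient map from the free algebra. -/
def proj : FreeAlgebra O (Gen d α) →ₐ[O] Alg O d α := RingQuot.mkAlgHom O _

/-- `e(i) ∈ R_α`. -/
def idem (i : Seq d α) : Alg O d α := proj O (fe O i)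
/-- `y_r ∈ R_α`. -/
def y (r : Fin d) : Alg O d α := proj O (fy O r)
/-- `ψ_r ∈ R_α`. -/
def psi (r : Fin (d - 1)) : Alg O d α := proj O (fpsi O r)

/-- Products of the homogeneous generators `e(i)`, `y_r`, `ψ_r e(i)` of total degree `n`. -/
inductive HomProd : ℤ → Alg O d α → Prop
  | e (i : Seq d α) : HomProd 0 (idem O i)
  | y (r : Fin d) : HomProd 2 (y O r)
  | psi (r : Fin (d - 1)) (i : Seq d α) :
      HomProd (-cartan (i.1 (lo r)) (i.1 (hi r))) (psi O r * idem O i)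
  | mul {m n : ℤ} {a b : Alg O d α} : HomProd m a → HomProd n b → HomProd (m + n) (a * b)

/-- The degree `n` component of `R_α`, for the grading with
`deg e(i) = 0`, `deg y_r = 2`, `deg ψ_r e(i) = -a_{i_r, i_{r+1}}`. -/
def algDeg (d : ℕ) (α : QPlus e) (n : ℤ) : Submodule O (Alg O d α) :=
  Submodule.span O {a | HomProd O n a}

/-- `ψ_w`, the product of the `ψ_r` along the preferred reduced decomposition of `w`. -/
def psiPerm (c : Preferred) (w : Equiv.Perm (Fin d)) : Alg O d α :=
  ((c.word w).map (psi O)).prod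

end Algebra

/-! ### The sign isomorphism -/

section Sign

variable (O : Type*) [CommRing O] {e d : ℕ} {α β : QPlus e}

theorem QPlus.neg_neg (α : QPlus e) : α.neg.neg = α := by
  unfold QPlus.neg
  rw [← Finsupp.mapDomain_comp]
  simp

theorem weight_neg (i : Fin d → ZMod e) : weight (fun r => -i r) = (weight i).neg := by
  simp only [weight, QPlus.neg]
  rw [Finsupp.mapDomain_finsetSum]
  simp

/-- `-i ∈ I^β` for `i ∈ I^α` and `β = α'`. -/
def Seq.neg (h : β = α.neg) (i : Seq d α) : Seq d β :=
  ⟨fun r => -i.1 r, by rw [weight_neg, i.2, h]⟩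

theorem arrow_neg (i j : ZMod e) : Arrow (-i) (-j) ↔ Arrow j i := by
  unfold Arrow
  constructor <;> intro h <;> linear_combination h

theorem Seq.neg_injective (h : β = α.neg) : Function.Injective (Seq.neg (d := d) h) := by
  intro i j hij
  refine Subtype.ext (funext fun r => ?_)
  have := congrFun (congrArg Subtype.val hij) r
  simpa [Seq.neg] using this

theorem Seq.neg_neg (h : β = α.neg) (h' : α = β.neg) (i : Seq d α) :
    Seq.neg h' (Seq.neg h i) = i :=
  Subtype.ext (funext fun r => by simp [Seq.neg])

theorem Seq.neg_swap (h : β = α.neg) (r : Fin (d - 1)) (i : Seq d α) :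
    (i.swap r).neg h = (i.neg h).swap r := rfl

/-- The images of the generators under `sgn`. -/
def sgnGen (h : β = α.neg) : Gen d α → Alg O d β
  | .e i => idem O (i.neg h)
  | .y r => -y O r
  | .psi r => -psi O r

theorem proj_rel {a b : FreeAlgebra O (Gen d α)} (h : Rel O a b) : proj O a = proj O b :=
  RingQuot.mkAlgHom_rel O h

theorem sgn_rel (h : β = α.neg) {a b : FreeAlgebra O (Gen d α)} (hab : Rel O a b) :
    FreeAlgebra.lift O (sgnGen O h) a = FreeAlgebra.lift O (sgnGen O h) b := by
  have he (i : Seq d α) :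
      FreeAlgebra.lift O (sgnGen O h) (fe O i) = proj O (fe O (i.neg h)) := by
    simp [fe, sgnGen, idem]
  have hy (r : Fin d) :
      FreeAlgebra.lift O (sgnGen O h) (fy O r) = -proj O (fy O r) := by
    simp [fy, sgnGen, y]
  have hpsi (r : Fin (d - 1)) :
      FreeAlgebra.lift O (sgnGen O h) (fpsi O r) = -proj O (fpsi O r) := by
    simp [fpsi, sgnGen, psi]
  have hdelta (r : Fin (d - 1)) (i : Seq d α) :
      FreeAlgebra.lift O (sgnGen O h) (delta O r i) = proj O (delta O r (i.neg h)) := by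
    by_cases h1 : i.1 (lo r) = i.1 (hi r) <;> simp [delta, Seq.neg, h1]
  have hquad (r : Fin (d - 1)) (i : Seq d α) :
      FreeAlgebra.lift O (sgnGen O h) (quad O r i) = proj O (quad O r (i.neg h)) := by
    by_cases h1 : i.1 (lo r) = i.1 (hi r) <;>
    by_cases h2 : Arrow (i.1 (lo r)) (i.1 (hi r)) <;>
    by_cases h3 : Arrow (i.1 (hi r)) (i.1 (lo r)) <;>
    simp [quad, Seq.neg, arrow_neg, h1, h2, h3, hy] <;> noncomm_ring
  have hbraid (r s : Fin (d - 1)) (i : Seq d α) :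
      FreeAlgebra.lift O (sgnGen O h) (braid O r s i) = -proj O (braid O r s (i.neg h)) := by
    by_cases h1 : i.1 (hi s) = i.1 (lo r) <;>
    by_cases h2 : Arrow (i.1 (lo r)) (i.1 (lo s)) <;>
    by_cases h3 : Arrow (i.1 (lo s)) (i.1 (lo r)) <;>
    simp [braid, Seq.neg, arrow_neg, h1, h2, h3, hy, -nsmul_eq_mul]
    all_goals abel
  induction hab with
  | idem i j =>
    have := proj_rel O (Rel.idem (O := O) (i.neg h) (j.neg h))
    by_cases hij : i = j
    · subst hij
      simpa [he] using this
    · have hij' : i.neg h ≠ j.neg h := fun h' => hij (Seq.neg_injective h h')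
      simpa [he, hij, hij'] using this
  | unit =>
    have := proj_rel O (Rel.unit (O := O) (d := d) (α := β))
    simp only [map_sum, he, map_one] at this ⊢
    rw [← this]
    have hα : α = β.neg := by rw [h, QPlus.neg_neg]
    exact Equiv.sum_comp
      (⟨Seq.neg h, Seq.neg hα, Seq.neg_neg h hα, Seq.neg_neg hα h⟩ : Seq d α ≃ Seq d β)
      (fun i => proj O (fe O i))
  | y_e r i =>
    have := proj_rel O (Rel.y_e (O := O) r (i.neg h))
    simpa [he, hy] using this
  | psi_e r i =>
    have := proj_rel O (Rel.psi_e (O := O) r (i.neg h))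
    simpa [he, hpsi, Seq.neg_swap] using this
  | y_y r s =>
    have := proj_rel O (Rel.y_y (O := O) (α := β) r s)
    simpa [hy] using this
  | psi_y r s h₁ h₂ =>
    have := proj_rel O (Rel.psi_y (O := O) (α := β) r s h₁ h₂)
    simpa [hy, hpsi] using this
  | psi_psi r s hrs =>
    have := proj_rel O (Rel.psi_psi (O := O) (α := β) r s hrs)
    simpa [hpsi] using this
  | psi_y_hi r i =>
    have := proj_rel O (Rel.psi_y_hi (O := O) r (i.neg h))
    simpa [he, hy, hpsi, hdelta] using this
  | y_hi_psi r i =>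
    have := proj_rel O (Rel.y_hi_psi (O := O) r (i.neg h))
    simpa [he, hy, hpsi, hdelta] using this
  | psi_sq r i =>
    have := proj_rel O (Rel.psi_sq (O := O) r (i.neg h))
    simpa [he, hpsi, hquad] using this
  | psi_braid r s hrs i =>
    have := congrArg (fun x => -x) (proj_rel O (Rel.psi_braid (O := O) r s hrs (i.neg h)))
    simp only [map_mul, map_add, he, hpsi, hbraid] at this ⊢
    simp only [neg_mul, mul_neg, _root_.neg_neg, neg_inj] at this ⊢
    rw [this]
    noncomm_ring

/-- The algebra homomorphism `sgn : R_α → R_β` for `β = α'`. -/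
def sgnHom (h : β = α.neg) : Alg O d α →ₐ[O] Alg O d β :=
  RingQuot.liftAlgHom O ⟨FreeAlgebra.lift O (sgnGen O h), fun _ _ => sgn_rel O h⟩

theorem sgnHom_proj (h : β = α.neg) (x : FreeAlgebra O (Gen d α)) :
    sgnHom O h (proj O x) = FreeAlgebra.lift O (sgnGen O h) x :=
  RingQuot.liftAlgHom_mkAlgHom_apply O _ _ x

theorem sgnHom_idem (h : β = α.neg) (i : Seq d α) :
    sgnHom O h (idem O i) = idem O (i.neg h) := by
  rw [idem, sgnHom_proj]; simp [fe, sgnGen]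

theorem sgnHom_y (h : β = α.neg) (r : Fin d) :
    sgnHom O h (y O r) = -y O r := by
  rw [y, sgnHom_proj]; simp [fy, sgnGen, y]

theorem sgnHom_psi (h : β = α.neg) (r : Fin (d - 1)) :
    sgnHom O h (psi O r) = -psi O r := by
  rw [psi, sgnHom_proj]; simp [fpsi, sgnGen, psi]

theorem sgnHom_sgnHom (h : β = α.neg) (h' : α = β.neg) :
    (sgnHom O h').comp (sgnHom O (d := d) h) = AlgHom.id O _ := by
  refine RingQuot.ringQuot_ext' O _ _ (FreeAlgebra.hom_ext (funext fun g => ?_))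
  cases g with
  | e i =>
    change sgnHom O h' (sgnHom O h (idem O i)) = idem O i
    rw [sgnHom_idem, sgnHom_idem, Seq.neg_neg]
  | y r =>
    change sgnHom O h' (sgnHom O h (y O r)) = y O r
    rw [sgnHom_y, map_neg, sgnHom_y, _root_.neg_neg]
  | psi r =>
    change sgnHom O h' (sgnHom O h (psi O r)) = psi O r
    rw [sgnHom_psi, map_neg, sgnHom_psi, _root_.neg_neg]

/-- The sign isomorphism `sgn : R_α → R_{α'}`,
`e(i) ↦ e(-i)`, `y_r ↦ -y_r`, `ψ_r ↦ -ψ_r`. -/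
def sgn (d : ℕ) (α : QPlus e) : Alg O d α ≃ₐ[O] Alg O d α.neg :=
  AlgEquiv.ofAlgHom (sgnHom O rfl) (sgnHom O (QPlus.neg_neg α).symm)
    (sgnHom_sgnHom O _ _) (sgnHom_sgnHom O _ _)

end Sign

/-- The `A`-module obtained from a `B`-module `M` by restriction along `f : A → B`. -/
def Twist {A B : Type*} [Ring A] [Ring B] (_f : A →+* B) (M : Type*) := M

section Twist

variable {A B : Type*} [Ring A] [Ring B] (f : A →+* B) (M : Type*) [AddCommGroup M]

instance : AddCommGroup (Twist f M) := inferInstanceAs (AddCommGroup M)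
instance [Module B M] : Module A (Twist f M) := Module.compHom M f

end Twist

/-- Graded modules `M` and `N` over `A`, with homogeneous components `P n` and `Q n`, are
isomorphic as graded modules: there is an `A`-linear isomorphism that preserves degrees. -/
def GradedIso {A M N : Type*} [Ring A] [AddCommGroup M] [AddCommGroup N] [Module A M] [Module A N]
    (P : ℤ → AddSubgroup M) (Q : ℤ → AddSubgroup N) : Prop :=
  ∃ φ : M ≃ₗ[A] N, ∀ (n : ℤ) (x : M), x ∈ P n ↔ φ x ∈ Q n

/-- The grading of `M^f`, which is that of `M`. -/
def twistDeg {A B M : Type*} [Ring A] [Ring B] [AddCommGroup M] (f : A →+* B)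
    (P : ℤ → AddSubgroup M) : ℤ → AddSubgroup (Twist f M) := P

/-! ### Multipartitions

Rows, columns and components are numbered from `0`. -/

/-- A node `(row, col, comp)`. -/
@[ext]
structure Node (l : ℕ) where
  row : ℕ
  col : ℕ
  comp : Fin l

/-- The node `A' = (b, a, l - m + 1)` for `A = (a, b, m)`. -/
def Node.conj {l : ℕ} (A : Node l) : Node l := ⟨A.col, A.row, A.comp.rev⟩

theorem Node.conj_conj {l : ℕ} (A : Node l) : A.conj.conj = A := by
  simp [Node.conj]

/-- The residue of a node with respect to `κ`. -/
def res {e l : ℕ} (κ : Fin l → ZMod e) (A : Node l) : ZMod e :=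
  κ A.comp + ((A.col : ZMod e) - (A.row : ZMod e))

open Classical in
/-- The nodes of the multipartition `μ`. -/
def nodes {l : ℕ} (μ : Fin l → YoungDiagram) : Finset (Node l) :=
  Finset.univ.biUnion fun m => (μ m).cells.image fun x => ⟨x.1, x.2, m⟩

theorem mem_nodes {l : ℕ} {μ : Fin l → YoungDiagram} {A : Node l} :
    A ∈ nodes μ ↔ (A.row, A.col) ∈ μ A.comp := by
  obtain ⟨a, b, m⟩ := A
  simp [nodes]

/-- The residue content of `μ`. -/
def content {e l : ℕ} (κ : Fin l → ZMod e) (μ : Fin l → YoungDiagram) : QPlus e :=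
  ∑ A ∈ nodes μ, Finsupp.single (res κ A) 1

/-- The `l`-multipartitions with residue content `α`. -/
def Par {e l : ℕ} (κ : Fin l → ZMod e) (α : QPlus e) :=
  {μ : Fin l → YoungDiagram // content κ μ = α}

/-- `κ' = (-k_l, …, -k_1)`. -/
def conjCharge {e l : ℕ} (κ : Fin l → ZMod e) : Fin l → ZMod e := fun m => -κ m.rev

/-- The conjugate multipartition: the components are transposed and their order is reversed. -/
def conjDiagram {l : ℕ} (μ : Fin l → YoungDiagram) : Fin l → YoungDiagram :=
  fun m => (μ m.rev).transpose

theorem conj_mem_nodes {l : ℕ} {μ : Fin l → YoungDiagram} {A : Node l} :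
    A.conj ∈ nodes (conjDiagram μ) ↔ A ∈ nodes μ := by
  rw [mem_nodes, mem_nodes]
  simp [Node.conj, conjDiagram, YoungDiagram.mem_transpose]

theorem res_conj {e l : ℕ} (κ : Fin l → ZMod e) (A : Node l) :
    res (conjCharge κ) A.conj = -res κ A := by
  simp only [res, conjCharge, Node.conj, Fin.rev_rev]
  ring

theorem content_conj {e l : ℕ} (κ : Fin l → ZMod e) (μ : Fin l → YoungDiagram) :
    content (conjCharge κ) (conjDiagram μ) = (content κ μ).neg := by
  unfold content QPlus.neg
  rw [Finsupp.mapDomain_finsetSum]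
  symm
  refine Finset.sum_bij' (fun A _ => A.conj) (fun A _ => A.conj) ?_ ?_ ?_ ?_ ?_
  · exact fun A hA => conj_mem_nodes.2 hA
  · intro A hA
    rw [← A.conj_conj] at hA
    exact conj_mem_nodes.1 hA
  · exact fun A _ => A.conj_conj
  · exact fun A _ => A.conj_conj
  · intro A _
    rw [res_conj, Finsupp.mapDomain_single]

/-- The conjugate `μ' ∈ 𝒫^{κ'}_{α'}` of `μ ∈ 𝒫^κ_α`. -/
def Par.conj {e l : ℕ} {κ : Fin l → ZMod e} {α : QPlus e} (μ : Par κ α) :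
    Par (conjCharge κ) α.neg :=
  ⟨conjDiagram μ.1, by rw [content_conj, μ.2]⟩

theorem ht_neg {e : ℕ} (α : QPlus e) : ht α.neg = ht α := by
  induction α using Finsupp.induction_linear with
  | zero => simp [ht, QPlus.neg]
  | add f g hf hg =>
    simp only [ht, QPlus.neg, Finsupp.mapDomain_add, map_add] at *
    rw [hf, hg]
  | single i a => simp [ht, QPlus.neg, Finsupp.degree_single]

theorem card_nodes {e l d : ℕ} {κ : Fin l → ZMod e} {α : QPlus e} (hd : ht α = d)
    (μ : Par κ α) : Fintype.card {A // A ∈ nodes μ.1} = d := by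
  obtain ⟨μ, rfl⟩ := μ
  rw [Fintype.card_coe, ← hd]
  simp [ht, content, map_sum, Finsupp.degree_single]

/-! ### Tableaux -/

/-- The `μ`-tableaux; the entries are `0, …, d - 1`. -/
abbrev Tab {l : ℕ} (d : ℕ) (μ : Fin l → YoungDiagram) := {A // A ∈ nodes μ} ≃ Fin d

open Classical in
/-- The bijection that numbers the elements of `N` by `0, …, d - 1` in the order of increasing
`key`. -/
def numbering {N L : Type*} [Fintype N] [LinearOrder L] (key : N → L)
    (hkey : Function.Injective key) {d : ℕ} (hd : Fintype.card N = d) : N ≃ Fin d :=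
  Equiv.ofBijective
    (fun A => ⟨(Finset.univ.filter fun B => key B < key A).card, by
      rw [← hd, ← Finset.card_univ]
      exact Finset.card_lt_card (Finset.filter_ssubset.2 ⟨A, Finset.mem_univ A, lt_irrefl _⟩)⟩)
    (by
      rw [Fintype.bijective_iff_injective_and_card]
      refine ⟨?_, by simp [hd]⟩
      have hlt : ∀ A B : N, key A < key B →
          (Finset.univ.filter fun C => key C < key A).card <
            (Finset.univ.filter fun C => key C < key B).card := by
        intro A B h
        refine Finset.card_lt_card ((Finset.ssubset_iff_of_subset ?_).2 ⟨A, ?_, ?_⟩)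
        · intro C hC
          simp only [Finset.mem_filter, Finset.mem_univ, true_and] at hC ⊢
          exact hC.trans h
        · simpa using h
        · simp
      intro A B hAB
      have hAB' := congrArg Fin.val hAB
      simp only at hAB'
      rcases lt_trichotomy (key A) (key B) with h | h | h
      · exact absurd hAB' (hlt A B h).ne
      · exact hkey h
      · exact absurd hAB' (hlt B A h).ne')

section Tableaux

variable {e l d : ℕ} {κ : Fin l → ZMod e} {α : QPlus e}

/-- The tableau `T^μ`: along the rows from left to right, from the top row to the bottom row,
from the first component to the last. -/
def rowTab (hd : ht α = d) (μ : Par κ α) : Tab d μ.1 :=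
  numbering (fun A => toLex (A.1.comp, toLex (A.1.row, A.1.col)))
    (fun A B h => by
      simp only [EmbeddingLike.apply_eq_iff_eq, Prod.mk.injEq] at h
      exact Subtype.ext (Node.ext h.2.1 h.2.2 h.1))
    (card_nodes hd μ)

/-- The tableau `T_μ`: along the columns from top to bottom, from the leftmost column to the
rightmost column, from the last component to the first. -/
def colTab (hd : ht α = d) (μ : Par κ α) : Tab d μ.1 :=
  numbering (fun A => toLex (A.1.comp.rev, toLex (A.1.col, A.1.row)))
    (fun A B h => by
      simp only [EmbeddingLike.apply_eq_iff_eq, Prod.mk.injEq, Fin.rev_inj] at h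
      exact Subtype.ext (Node.ext h.2.2 h.2.1 h.1))
    (card_nodes hd μ)

/-- The residue sequence of a tableau. -/
def resSeq (μ : Par κ α) (T : Tab d μ.1) : Seq d α :=
  ⟨fun r => res κ (T.symm r).1, by
    refine Eq.trans ?_ μ.2
    unfold weight content
    rw [Equiv.sum_comp T.symm fun A => Finsupp.single (res κ A.1) 1]
    exact Finset.sum_coe_sort (nodes μ.1) fun A => Finsupp.single (res κ A) 1⟩

/-- The permutation `w` with `w S = T`; it is `w^T` for `S = T^μ` and `w_T` for `S = T_μ`. -/
def permTo {μ : Fin l → YoungDiagram} (S T : Tab d μ) : Equiv.Perm (Fin d) := S.symm.trans T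

/-! ### Degree and codegree of standard tableaux -/

/-- The finite set of nodes `s` is the diagram of a multipartition. -/
def IsDiagram (s : Set (Node l)) : Prop :=
  ∀ A ∈ s, ∀ B : Node l, B.comp = A.comp → B.row ≤ A.row → B.col ≤ A.col → B ∈ s

/-- `A` is a removable node of `s`. -/
def Removable (s : Set (Node l)) (A : Node l) : Prop := A ∈ s ∧ IsDiagram (s \ {A})

/-- `A` is an addable node for `s`. -/
def Addable (s : Set (Node l)) (A : Node l) : Prop := A ∉ s ∧ IsDiagram (insert A s)

/-- `B` is strictly below `A`. -/
def Below (A B : Node l) : Prop := A.comp < B.comp ∨ (A.comp = B.comp ∧ A.row < B.row)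

/-- `d_A(s)`, where `i = res A`: the number of addable `i`-nodes of `s` strictly below `A` minus
the number of removable `i`-nodes of `s` strictly below `A`. -/
def dBelow (κ : Fin l → ZMod e) (s : Set (Node l)) (A : Node l) : ℤ :=
  ({B | Addable s B ∧ res κ B = res κ A ∧ Below A B}.ncard : ℤ) -
    ({B | Removable s B ∧ res κ B = res κ A ∧ Below A B}.ncard : ℤ)

/-- `d^A(s)`, where `i = res A`: the number of addable `i`-nodes of `s` strictly above `A` minus
the number of removable `i`-nodes of `s` strictly above `A`. -/
def dAbove (κ : Fin l → ZMod e) (s : Set (Node l)) (A : Node l) : ℤ :=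
  ({B | Addable s B ∧ res κ B = res κ A ∧ Below B A}.ncard : ℤ) -
    ({B | Removable s B ∧ res κ B = res κ A ∧ Below B A}.ncard : ℤ)

/-- The degree of a standard tableau `T`. The recursion `deg T = d_A(μ) + deg T_{<d}`, with `A` the
node occupied by the largest entry, is written as a sum over all entries `r`, with the shape of
`T_{≤ r}` in place of `μ`. -/
def deg (κ : Fin l → ZMod e) {μ : Fin l → YoungDiagram} (T : Tab d μ) : ℤ :=
  ∑ r : Fin d, dBelow κ {B | ∃ h : B ∈ nodes μ, T ⟨B, h⟩ ≤ r} (T.symm r).1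

/-- The codegree of a standard tableau `T`. The recursion `codeg T = d^A(μ_A) + codeg T_{<d}`, with
`A` the node occupied by the largest entry, is written as a sum over all entries `r`, with the shape
of `T_{< r}` in place of `μ_A`. -/
def codeg (κ : Fin l → ZMod e) {μ : Fin l → YoungDiagram} (T : Tab d μ) : ℤ :=
  ∑ r : Fin d, dAbove κ {B | ∃ h : B ∈ nodes μ, T ⟨B, h⟩ < r} (T.symm r).1

/-! ### Garnir belts and bricks -/

/-- A Garnir belt, with its bricks. For rows, `first` is the part of the belt in the row of `A` and
`second` the part in the next row; for columns, `first` is the part in the column of `A` and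
`second` the part in the next column. -/
structure Belt (l : ℕ) where
  first : Finset (Node l)
  second : Finset (Node l)
  bricks : Finset (Finset (Node l))

/-- `A` is a row Garnir node of `μ`. -/
def IsRowGarnir (μ : Fin l → YoungDiagram) (A : Node l) : Prop :=
  A ∈ nodes μ ∧ (⟨A.row + 1, A.col, A.comp⟩ : Node l) ∈ nodes μ

/-- `A` is a column Garnir node of `μ`. -/
def IsColGarnir (μ : Fin l → YoungDiagram) (A : Node l) : Prop :=
  A ∈ nodes μ ∧ (⟨A.row, A.col + 1, A.comp⟩ : Node l) ∈ nodes μ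

open Classical in
/-- The `e` successive nodes in a row, the leftmost of which is `H`. -/
def rowBrick (e : ℕ) (H : Node l) : Finset (Node l) :=
  (Finset.range e).image fun j => ⟨H.row, H.col + j, H.comp⟩

open Classical in
/-- The `e` successive nodes in a column, the topmost of which is `H`. -/
def colBrick (e : ℕ) (H : Node l) : Finset (Node l) :=
  (Finset.range e).image fun j => ⟨H.row + j, H.col, H.comp⟩

open Classical in
/-- The row `A`-Garnir belt. There are no bricks if `e = 0`. -/
def rowBelt (κ : Fin l → ZMod e) (μ : Fin l → YoungDiagram) (A : Node l) : Belt l :=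
  let first := (nodes μ).filter fun B => B.comp = A.comp ∧ B.row = A.row ∧ A.col ≤ B.col
  let second := (nodes μ).filter fun B => B.comp = A.comp ∧ B.row = A.row + 1 ∧ B.col ≤ A.col
  { first := first
    second := second
    bricks := ((nodes μ).filter fun H =>
      0 < e ∧ res κ H = res κ A ∧ rowBrick e H ⊆ first ∪ second).image (rowBrick e) }

open Classical in
/-- The column `A`-Garnir belt. There are no bricks if `e = 0`. -/
def colBelt (κ : Fin l → ZMod e) (μ : Fin l → YoungDiagram) (A : Node l) : Belt l :=
  let first := (nodes μ).filter fun B => B.comp = A.comp ∧ B.col = A.col ∧ A.row ≤ B.row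
  let second := (nodes μ).filter fun B => B.comp = A.comp ∧ B.col = A.col + 1 ∧ B.row ≤ A.row
  { first := first
    second := second
    bricks := ((nodes μ).filter fun H =>
      0 < e ∧ res κ H = res κ A ∧ colBrick e H ⊆ first ∪ second).image (colBrick e) }

/-- `k`, the number of bricks in the belt. -/
def Belt.k (b : Belt l) : ℕ := b.bricks.card

open Classical in
/-- `f`, the number of bricks in the row (or column) of `A`. -/
def Belt.f (b : Belt l) : ℕ := (b.bricks.filter fun x => x ⊆ b.first).card

/-- The node `B` lies in a brick. -/
def Belt.InBrick (b : Belt l) (B : Node l) : Prop := ∃ x ∈ b.bricks, B ∈ x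

open Classical in
/-- The order of the nodes in the Garnir tableau: the nodes outside the belt keep their entries, and
in the belt the second part comes before the first part. Here `before B` says that the entry of `B`
in the initial tableau is smaller than all entries of the belt. -/
def Belt.garnirClass (b : Belt l) (before : Prop) (B : Node l) : ℕ :=
  if B ∈ b.second then 1
  else if B ∈ b.first then 4
  else if before then 0 else 5

open Classical in
/-- The order of the nodes in the extremal tableau: as in the Garnir tableau, except that the bricks
in the first part of the belt come before the bricks in the second part. -/
def Belt.topClass (b : Belt l) (before : Prop) (B : Node l) : ℕ :=
  if B ∈ b.second then (if b.InBrick B then 3 else 1)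
  else if B ∈ b.first then (if b.InBrick B then 2 else 4)
  else if before then 0 else 5

/-- The entries of the initial tableau `T` in the belt are all larger than that of `B`. -/
def Belt.Before {μ : Fin l → YoungDiagram} (b : Belt l) (T : Tab d μ) (B : {A // A ∈ nodes μ}) :
    Prop :=
  ∀ C : {A // A ∈ nodes μ}, C.1 ∈ b.first ∨ C.1 ∈ b.second → T B < T C

/-- The tableau in which the nodes are numbered by increasing `cls`, and nodes of the same class in
the order of their entries in `T`. -/
def reorder {μ : Fin l → YoungDiagram} (T : Tab d μ) (cls : {A // A ∈ nodes μ} → ℕ) : Tab d μ :=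
  numbering (fun B => toLex (cls B, T B))
    (fun A B h => by
      simp only [EmbeddingLike.apply_eq_iff_eq, Prod.mk.injEq] at h
      exact h.2)
    (by simpa using Fintype.card_congr T)

/-- The Garnir tableau: `G^A` if `T = T^μ` and `b` is the row Garnir belt of `A`, and `G_A` if
`T = T_μ` and `b` is the column Garnir belt of `A`. The belt occupies an interval of entries of `T`,
and these are inserted again, first along the second part of the belt, then along the first part. -/
def Belt.garnirTab {μ : Fin l → YoungDiagram} (b : Belt l) (T : Tab d μ) : Tab d μ :=
  reorder T fun B => b.garnirClass (b.Before T B) B.1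

/-- The tableau `T^A` (for rows) or `T_A` (for columns), obtained from the Garnir tableau by the
brick permutation which moves the bricks in the first part of the belt before those in the second
part. -/
def Belt.topTab {μ : Fin l → YoungDiagram} (b : Belt l) (T : Tab d μ) : Tab d μ :=
  reorder T fun B => b.topClass (b.Before T B) B.1

/-- The smallest entry of the Garnir tableau which is contained in a brick. -/
def Belt.n {μ : Fin l → YoungDiagram} (b : Belt l) (T : Tab d μ) : ℕ :=
  sInf {t | ∃ B : {A // A ∈ nodes μ}, b.InBrick B.1 ∧ (b.garnirTab T B : ℕ) = t}

/-- The transposition `(a, a')` of `S_d` (both letters are smaller than `d` wherever it is used). -/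
def transp (d a a' : ℕ) : Equiv.Perm (Fin d) :=
  if h : a < d ∧ a' < d then Equiv.swap ⟨a, h.1⟩ ⟨a', h.2⟩ else 1

/-- The permutation that swaps the `r`th and the `(r+1)`st of the `k` consecutive blocks of `e`
letters, the first of which starts with the letter `n`. -/
def blockSwap (d e n r : ℕ) : Equiv.Perm (Fin d) :=
  ((List.range e).map fun q => transp d (n + r * e + q) (n + r * e + q + e)).prod

end Tableaux

/-! ### Specht modules -/

section Specht

variable (O : Type*) [CommRing O] {e l d : ℕ} (c : Preferred) {κ : Fin l → ZMod e} {α : QPlus e}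

/-- The element `τ_r = (σ_r + 1) e(i)`, with `σ_r = ε ψ_{w_r} e(i)`, where `i` is the residue
sequence of the Garnir tableau and `w_r` swaps the bricks `r` and `r + 1`. -/
def tau (ε : O) (μ : Par κ α) (T : Tab d μ.1) (b : Belt l) (r : Fin (b.k - 1)) : Alg O d α :=
  let i := resSeq μ (b.garnirTab T)
  (ε • (psiPerm O c (blockSwap d e (b.n T) r) * idem O i) + 1) * idem O i

/-- The Garnir element `∑ τ_u ψ_w`, where `u` runs over the minimal length left coset representatives
of `S_f × S_{k-f}` in the brick permutation group `S_k`, `τ_u` is the product of the `τ_r` along a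
reduced decomposition of `u`, and `w` takes the initial tableau `T` to `T^A` (or `T_A`). -/
def garnir (ε : O) (μ : Par κ α) (T : Tab d μ.1) (b : Belt l) : Alg O d α :=
  ∑ u ∈ cosetReps b.k b.f,
    ((c.word u).map (tau O c ε μ T b)).prod * psiPerm O c (permTo T (b.topTab T))

/-- The row Garnir element `g^A`. -/
def rowGarnir (hd : ht α = d) (μ : Par κ α) (A : Node l) : Alg O d α :=
  garnir O c 1 μ (rowTab hd μ) (rowBelt κ μ.1 A)

/-- The column Garnir element `g_A`. -/
def colGarnir (hd : ht α = d) (μ : Par κ α) (A : Node l) : Alg O d α :=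
  garnir O c ((-1) ^ e) μ (colTab hd μ) (colBelt κ μ.1 A)

/-- `r →_T r + 1`: the letter `r + 1` is in the same row of `T` as `r`, strictly to the right. -/
def RowNext {μ : Fin l → YoungDiagram} (T : Tab d μ) (r : Fin (d - 1)) : Prop :=
  (T.symm (lo r)).1.comp = (T.symm (hi r)).1.comp ∧
  (T.symm (lo r)).1.row = (T.symm (hi r)).1.row ∧
  (T.symm (lo r)).1.col < (T.symm (hi r)).1.col

/-- `r ↓_T r + 1`: the letter `r + 1` is in the same column of `T` as `r`, strictly below. -/
def ColNext {μ : Fin l → YoungDiagram} (T : Tab d μ) (r : Fin (d - 1)) : Prop :=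
  (T.symm (lo r)).1.comp = (T.symm (hi r)).1.comp ∧
  (T.symm (lo r)).1.col = (T.symm (hi r)).1.col ∧
  (T.symm (lo r)).1.row < (T.symm (hi r)).1.row

open Classical in
/-- The left ideal of relations of the generator `z^μ` of the row Specht module. -/
def rowIdeal (hd : ht α = d) (μ : Par κ α) : Submodule (Alg O d α) (Alg O d α) :=
  Submodule.span (Alg O d α)
    ({x | ∃ j : Seq d α, x = idem O j - if j = resSeq μ (rowTab hd μ) then 1 else 0} ∪
     {x | ∃ r : Fin d, x = y O r} ∪
     {x | ∃ r : Fin (d - 1), RowNext (rowTab hd μ) r ∧ x = psi O r} ∪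
     {x | ∃ A : Node l, IsRowGarnir μ.1 A ∧ x = rowGarnir O c hd μ A})

open Classical in
/-- The left ideal of relations of the generator `z_μ` of the column Specht module. -/
def colIdeal (hd : ht α = d) (μ : Par κ α) : Submodule (Alg O d α) (Alg O d α) :=
  Submodule.span (Alg O d α)
    ({x | ∃ j : Seq d α, x = idem O j - if j = resSeq μ (colTab hd μ) then 1 else 0} ∪
     {x | ∃ r : Fin d, x = y O r} ∪
     {x | ∃ r : Fin (d - 1), ColNext (colTab hd μ) r ∧ x = psi O r} ∪
     {x | ∃ A : Node l, IsColGarnir μ.1 A ∧ x = colGarnir O c hd μ A})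

/-- The universal row Specht module `S^μ`; the generator `z^μ` is the class of `1`. -/
abbrev RowSpecht (hd : ht α = d) (μ : Par κ α) := Alg O d α ⧸ rowIdeal O c hd μ

/-- The universal column Specht module `S_μ`; the generator `z_μ` is the class of `1`. -/
abbrev ColSpecht (hd : ht α = d) (μ : Par κ α) := Alg O d α ⧸ colIdeal O c hd μ

/-- The grading of `S^μ`, in which the generator has degree `deg T^μ`: the component of degree `n` is
the image of the component of degree `n - deg T^μ` of `R_α`. -/
def rowDeg (hd : ht α = d) (μ : Par κ α) (n : ℤ) : AddSubgroup (RowSpecht O c hd μ) :=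
  (algDeg O d α (n - deg κ (rowTab hd μ))).toAddSubgroup.map
    (rowIdeal O c hd μ).mkQ.toAddMonoidHom

/-- The grading of `S_μ`, in which the generator has degree `codeg T_μ`: the component of degree `n`
is the image of the component of degree `n - codeg T_μ` of `R_α`. -/
def colDeg (hd : ht α = d) (μ : Par κ α) (n : ℤ) : AddSubgroup (ColSpecht O c hd μ) :=
  (algDeg O d α (n - codeg κ (colTab hd μ))).toAddSubgroup.map
    (colIdeal O c hd μ).mkQ.toAddMonoidHom

end Specht

end KLR

end

namespace KLR

/-! ### Numberings -/

/-! Both Specht modules are cyclic, hence quotients of the KLR algebra by left ideals. It therefore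
suffices that `sgn` carries the left ideal of one onto that of the other and respects the degree
shifts.

Conjugation of nodes exchanges rows with columns, reverses the components and negates residues. It
takes $T^\mu$ to $T_{\mu'}$, row Garnir belts to column Garnir belts, bricks to bricks, and $G^A$,
$T^A$ to $G_{A'}$, $T_{A'}$. So the relations on idempotents, the $y_r$ and the $\psi_r$ correspond
up to sign, and the same permutations occur in the two Garnir elements. Along a word for $w$ the
sign map contributes $(-1)$ to the length, which is the sign of $w$. Exchanging two neighbouring
bricks is a product of $e$ transpositions, which turns the coefficient $1$ in $\tau_r$ into the
coefficient $(-1)^e$ in $\tau^r$, and back. Hence $g^A$ goes to $\pm g_{A'}$ (`sgnHom_garnir`), and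
`sgnHom_mem_span` gives the inclusion of ideals. The reverse inclusion is the same statement for
$\mu'$, because the inverse of `sgn` is again a sign map.

For the degrees (`codeg_conj`), let $A$ be removable from a diagram $s$. Since $e\ne1$, adjacent
nodes have different residues, so deleting $A$ does not affect whether another node of the same
residue is addable or removable. For such nodes "strictly below $A$" becomes "strictly above $A'$"
after conjugation. Thus each summand of $\deg T^\mu$ equals the corresponding summand of
$\operatorname{codeg}T_{\mu'}$. -/

/-- An entry is the number of elements with smaller key, and an order-preserving bijection matches
the sets being counted. -/
theorem numbering_congr {N N' L L' : Type*} [Fintype N] [Fintype N'] [LinearOrder L]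
    [LinearOrder L'] {key : N → L} {key' : N' → L'} (hkey : Function.Injective key)
    (hkey' : Function.Injective key') {d : ℕ} (hd : Fintype.card N = d)
    (hd' : Fintype.card N' = d) (φ : N ≃ N')
    (hφ : ∀ A B, key' (φ A) < key' (φ B) ↔ key A < key B) (A : N) :
    numbering key' hkey' hd' (φ A) = numbering key hkey hd A := by
  classical
  refine Fin.ext ?_
  change (Finset.univ.filter fun B => key' B < key' (φ A)).card =
    (Finset.univ.filter fun B => key B < key A).card
  symm
  refine Finset.card_equiv φ fun B => ?_
  simp [hφ]

theorem numbering_lt_iff {N L : Type*} [Fintype N] [LinearOrder L] {key : N → L}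
    (hkey : Function.Injective key) {d : ℕ} (hd : Fintype.card N = d) (A B : N) :
    numbering key hkey hd A < numbering key hkey hd B ↔ key A < key B := by
  classical
  have hmono : ∀ A B : N, key A ≤ key B → numbering key hkey hd A ≤ numbering key hkey hd B := by
    intro A B h
    change (Finset.univ.filter fun C => key C < key A).card ≤
      (Finset.univ.filter fun C => key C < key B).card
    refine Finset.card_le_card fun C hC => ?_
    simp only [Finset.mem_filter, Finset.mem_univ, true_and] at hC ⊢
    exact hC.trans_le h
  constructor
  · intro h
    by_contra h'
    exact absurd h (not_lt.2 (hmono B A (not_lt.1 h')))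
  · intro h
    refine lt_of_le_of_ne (hmono A B h.le) fun h' => ?_
    exact h.ne (congrArg key ((numbering key hkey hd).injective h'))

/-! ### Conjugation of nodes and tableaux -/

theorem Node.conj_injective {l : ℕ} : Function.Injective (Node.conj (l := l)) :=
  Function.LeftInverse.injective (g := Node.conj) Node.conj_conj

/-- Conjugation of nodes as a bijection between the diagrams of conjugate multipartitions. -/
def conjEquiv {l : ℕ} {μ μ' : Fin l → YoungDiagram}
    (hμ : ∀ A : Node l, A.conj ∈ nodes μ' ↔ A ∈ nodes μ) :
    {A // A ∈ nodes μ} ≃ {A // A ∈ nodes μ'} where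
  toFun A := ⟨A.1.conj, (hμ A.1).2 A.2⟩
  invFun A := ⟨A.1.conj, (hμ A.1.conj).1 (by rw [Node.conj_conj]; exact A.2)⟩
  left_inv A := Subtype.ext A.1.conj_conj
  right_inv A := Subtype.ext A.1.conj_conj

theorem conj_mem_symm {l : ℕ} {μ μ' : Fin l → YoungDiagram}
    (hμ : ∀ A : Node l, A.conj ∈ nodes μ' ↔ A ∈ nodes μ) (A : Node l) :
    A.conj ∈ nodes μ ↔ A ∈ nodes μ' := by
  rw [← hμ, Node.conj_conj]

theorem res_conj_symm {e l : ℕ} {κ κ' : Fin l → ZMod e}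
    (hκ : ∀ A : Node l, res κ' A.conj = -res κ A) (A : Node l) :
    res κ A.conj = -res κ' A := by
  have := hκ A.conj
  rw [Node.conj_conj] at this
  rw [this, neg_neg]

/-- The tableau `T'` is conjugate to `T`. -/
def TabConj {l d : ℕ} {μ μ' : Fin l → YoungDiagram}
    (hμ : ∀ A : Node l, A.conj ∈ nodes μ' ↔ A ∈ nodes μ) (T : Tab d μ) (T' : Tab d μ') : Prop :=
  ∀ A, T' (conjEquiv hμ A) = T A

section TabConj

variable {l d : ℕ} {μ μ' : Fin l → YoungDiagram}
  {hμ : ∀ A : Node l, A.conj ∈ nodes μ' ↔ A ∈ nodes μ}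

theorem TabConj.symm_apply {T : Tab d μ} {T' : Tab d μ'} (h : TabConj hμ T T') (r : Fin d) :
    (T'.symm r).1 = (T.symm r).1.conj := by
  have : T'.symm r = conjEquiv hμ (T.symm r) := by
    rw [Equiv.symm_apply_eq, h, Equiv.apply_symm_apply]
  rw [this]
  rfl

theorem TabConj.symm {T : Tab d μ} {T' : Tab d μ'} (h : TabConj hμ T T') :
    TabConj (conj_mem_symm hμ) T' T := by
  intro A
  rw [← h]
  exact congrArg T' (Subtype.ext A.1.conj_conj)

/-- The permutation only compares entries at the same node, so renaming the nodes leaves it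
unchanged. This is why both Garnir elements involve the same $\psi_w$. -/
theorem TabConj.permTo {S T : Tab d μ} {S' T' : Tab d μ'} (hS : TabConj hμ S S')
    (hT : TabConj hμ T T') : permTo S' T' = permTo S T := by
  ext r
  have : S'.symm r = conjEquiv hμ (S.symm r) := Subtype.ext (hS.symm_apply r)
  simp [KLR.permTo, this, hT _]

theorem TabConj.reorder {T : Tab d μ} {T' : Tab d μ'} (h : TabConj hμ T T')
    {cls : {A // A ∈ nodes μ} → ℕ} {cls' : {A // A ∈ nodes μ'} → ℕ}
    (hcls : ∀ A, cls' (conjEquiv hμ A) = cls A) :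
    TabConj hμ (reorder T cls) (reorder T' cls') := by
  refine numbering_congr _ _ _ _ (conjEquiv hμ) fun A B => ?_
  rw [hcls, hcls, h, h]

theorem TabConj.rowNext_iff {T : Tab d μ} {T' : Tab d μ'} (h : TabConj hμ T T')
    (r : Fin (d - 1)) : ColNext T' r ↔ RowNext T r := by
  simp [ColNext, RowNext, h.symm_apply, Node.conj]

end TabConj

/-! ### Initial tableaux and their residue sequences -/

section Initial

variable {e l d : ℕ} {κ κ' : Fin l → ZMod e} {α β : QPlus e}

/-- The key of a conjugate node in the column reading is literally the key of the node in the row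
reading: the component is reversed twice, and row and column are exchanged. -/
theorem tabConj_rowTab_colTab (hd : ht α = d) (hd' : ht β = d) (μ : Par κ α) (μ' : Par κ' β)
    (hμ : ∀ A : Node l, A.conj ∈ nodes μ'.1 ↔ A ∈ nodes μ.1) :
    TabConj hμ (rowTab hd μ) (colTab hd' μ') := by
  refine numbering_congr _ _ _ _ (conjEquiv hμ) fun A B => ?_
  simp [conjEquiv, Node.conj]

theorem resSeq_conj (μ : Par κ α) (μ' : Par κ' β) (h : β = α.neg)
    (hκ : ∀ A : Node l, res κ' A.conj = -res κ A)
    {hμ : ∀ A : Node l, A.conj ∈ nodes μ'.1 ↔ A ∈ nodes μ.1}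
    {T : Tab d μ.1} {T' : Tab d μ'.1} (hT : TabConj hμ T T') :
    resSeq μ' T' = (resSeq μ T).neg h := by
  refine Subtype.ext (funext fun r => ?_)
  change res κ' (T'.symm r).1 = -res κ (T.symm r).1
  rw [hT.symm_apply, hκ]

theorem rowTab_mono (hd : ht α = d) (μ : Par κ α) {A B : {A // A ∈ nodes μ.1}}
    (hc : B.1.comp = A.1.comp) (hrow : B.1.row ≤ A.1.row) (hcol : B.1.col ≤ A.1.col) :
    rowTab hd μ B ≤ rowTab hd μ A := by
  refine not_lt.1 fun hlt => not_le.2 ((numbering_lt_iff _ _ _ _).1 hlt) ?_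
  rw [Prod.Lex.toLex_le_toLex]
  refine Or.inr ⟨hc, ?_⟩
  rw [Prod.Lex.toLex_le_toLex]
  rcases hrow.lt_or_eq with h | h
  · exact Or.inl h
  · exact Or.inr ⟨h, hcol⟩

end Initial

/-! ### Degrees -/

section Degree

variable {e l d : ℕ}

theorem isDiagram_conj {s : Set (Node l)} (hs : IsDiagram s) : IsDiagram (Node.conj ⁻¹' s) :=
  fun A hA B hc hrow hcol => hs A.conj hA B.conj (by simp [Node.conj, hc]) hcol hrow

theorem isDiagram_conj_iff {s : Set (Node l)} : IsDiagram (Node.conj ⁻¹' s) ↔ IsDiagram s := by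
  refine ⟨fun h => ?_, isDiagram_conj⟩
  have := isDiagram_conj h
  rwa [← Set.preimage_comp, show Node.conj ∘ Node.conj = (id : Node l → Node l) from
    funext Node.conj_conj] at this

theorem conj_eq_iff {A B : Node l} : A.conj = B ↔ A = B.conj :=
  ⟨fun h => by rw [← h, Node.conj_conj], fun h => by rw [h, Node.conj_conj]⟩

theorem addable_conj_iff {s : Set (Node l)} {A : Node l} :
    Addable (Node.conj ⁻¹' s) A.conj ↔ Addable s A := by
  have : insert A.conj (Node.conj ⁻¹' s) = Node.conj ⁻¹' insert A s := by
    ext B; simp [conj_eq_iff]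
  rw [Addable, this, isDiagram_conj_iff, Set.mem_preimage, Node.conj_conj, Addable]

theorem removable_conj_iff {s : Set (Node l)} {A : Node l} :
    Removable (Node.conj ⁻¹' s) A.conj ↔ Removable s A := by
  have : (Node.conj ⁻¹' s) \ {A.conj} = Node.conj ⁻¹' (s \ {A}) := by
    ext B; simp [conj_eq_iff]
  rw [Removable, this, isDiagram_conj_iff, Set.mem_preimage, Node.conj_conj, Removable]

/-- The neighbour of `A` in the direction of `C`, south if possible and otherwise east, has a
residue differing by one from that of `A`. As $1\ne0$ in $\mathbb Z/e\mathbb Z$, it cannot be `C`.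
-/
theorem exists_next_le (κ : Fin l → ZMod e) (he : e ≠ 1) {A C : Node l} (hne : A ≠ C)
    (hc : A.comp = C.comp) (hrow : A.row ≤ C.row) (hcol : A.col ≤ C.col)
    (hres : res κ C = res κ A) :
    ∃ D : Node l, D ≠ A ∧ D ≠ C ∧ D.comp = A.comp ∧ A.row ≤ D.row ∧ A.col ≤ D.col ∧
      D.row ≤ C.row ∧ D.col ≤ C.col := by
  have h1 : (1 : ZMod e) ≠ 0 := by
    intro h
    have := (ZMod.natCast_eq_zero_iff 1 e).1 (by simpa using h)
    exact he (Nat.dvd_one.1 this)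
  rcases hrow.lt_or_eq with h | h
  · refine ⟨⟨A.row + 1, A.col, A.comp⟩, ?_, ?_, rfl, Nat.le_succ _, le_rfl, h, hcol⟩
    · intro h'; simpa using congrArg Node.row h'
    · rintro rfl
      apply h1
      simp only [res, Nat.cast_add, Nat.cast_one] at hres
      linear_combination -hres
  · have h' : A.col < C.col := lt_of_le_of_ne hcol fun h' => hne (Node.ext h h' hc)
    refine ⟨⟨A.row, A.col + 1, A.comp⟩, ?_, ?_, rfl, le_rfl, Nat.le_succ _, hrow, h'⟩
    · intro h'; simpa using congrArg Node.col h'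
    · rintro rfl
      apply h1
      simp only [res, Nat.cast_add, Nat.cast_one] at hres
      linear_combination hres

variable {κ : Fin l → ZMod e} {s : Set (Node l)} {A C : Node l}

/-- Otherwise a third node between `A` and `C` would lie in `s`, because `C` is addable, and would
have `A` to its north-west, so that `A` could not be removed. -/
theorem Addable.not_le (he : e ≠ 1) (hA : Removable s A) (hC : Addable s C)
    (hres : res κ C = res κ A) :
    ¬ (A.comp = C.comp ∧ A.row ≤ C.row ∧ A.col ≤ C.col) := by
  rintro ⟨hc, hrow, hcol⟩
  have hne : A ≠ C := by rintro rfl; exact hC.1 hA.1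
  obtain ⟨D, hDA, hDC, hDc, h1, h2, h3, h4⟩ := exists_next_le κ he hne hc hrow hcol hres
  have hD : D ∈ s := by
    have := hC.2 C (Set.mem_insert _ _) D (hDc.trans hc) h3 h4
    exact this.resolve_left hDC
  exact (hA.2 D ⟨hD, hDA⟩ A hDc.symm h1 h2).2 rfl

/-- Deleting `A` could only spoil the addability of a node that has `A` to its north-west, and
equality of residues rules this out. -/
theorem addable_sdiff_iff (he : e ≠ 1) (hs : IsDiagram s) (hA : Removable s A)
    (hres : res κ C = res κ A) (hne : C ≠ A) : Addable (s \ {A}) C ↔ Addable s C := by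
  constructor
  · rintro ⟨h1, h2⟩
    refine ⟨fun h => h1 ⟨h, hne⟩, ?_⟩
    rintro X (rfl | hX) B hc hrow hcol
    · rcases h2 X (Set.mem_insert _ _) B hc hrow hcol with h | h
      · exact Or.inl h
      · exact Or.inr h.1
    · exact Or.inr (hs X hX B hc hrow hcol)
  · intro hC
    refine ⟨fun h => hC.1 h.1, ?_⟩
    rintro X (rfl | hX) B hc hrow hcol
    · rcases hC.2 X (Set.mem_insert _ _) B hc hrow hcol with h | h
      · exact Or.inl h
      · refine Or.inr ⟨h, ?_⟩
        rintro rfl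
        exact Addable.not_le he hA hC hres ⟨hc, hrow, hcol⟩
    · exact Or.inr (hA.2 X hX B hc hrow hcol)

theorem removable_sdiff_iff (he : e ≠ 1) (hs : IsDiagram s) (hA : Removable s A)
    (hres : res κ C = res κ A) (hne : C ≠ A) : Removable (s \ {A}) C ↔ Removable s C := by
  constructor
  · rintro ⟨h1, h2⟩
    refine ⟨h1.1, ?_⟩
    rintro X ⟨hX, hXC⟩ B hc hrow hcol
    by_cases hXA : X = A
    · subst hXA
      refine ⟨hs X hX B hc hrow hcol, ?_⟩
      rintro rfl
      -- If the node to be removed lay north-west of the deleted one, a third node between them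
      -- would survive the deletion and block its removal.
      obtain ⟨D, hDB, hDX, hDc, h3, h4, h5, h6⟩ :=
        exists_next_le κ he hne hc hrow hcol hres.symm
      have hD : D ∈ s := hs X hX D (hDc.trans hc) h5 h6
      exact (h2 D ⟨⟨hD, hDX⟩, hDB⟩ B hDc.symm h3 h4).2 rfl
    · have := h2 X ⟨⟨hX, hXA⟩, hXC⟩ B hc hrow hcol
      exact ⟨this.1.1, this.2⟩
  · intro hC
    refine ⟨⟨hC.1, hne⟩, ?_⟩
    rintro X ⟨⟨hX, hXA⟩, hXC⟩ B hc hrow hcol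
    exact ⟨hA.2 X ⟨hX, hXA⟩ B hc hrow hcol, (hC.2 X ⟨hX, hXC⟩ B hc hrow hcol).2⟩

/-- Within one component, neither node lies weakly north-west of the other, so being in a lower row
is the same as being in a column further left. Conjugation turns columns into rows. -/
theorem below_conj_iff_of_addable (he : e ≠ 1) (hs : IsDiagram s) (hA : Removable s A)
    (hC : Addable s C) (hres : res κ C = res κ A) : Below C.conj A.conj ↔ Below A C := by
  simp only [Below, Node.conj, Fin.rev_lt_rev, Fin.rev_inj]
  refine or_congr Iff.rfl ⟨?_, ?_⟩
  · rintro ⟨hc, h⟩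
    refine ⟨hc.symm, lt_of_not_ge fun h' => hC.1 (hs A hA.1 C hc h' h.le)⟩
  · rintro ⟨hc, h⟩
    refine ⟨hc.symm, lt_of_not_ge fun h' => ?_⟩
    exact Addable.not_le he hA hC hres ⟨hc, h.le, h'⟩

/-- Two distinct removable nodes are never comparable in the north-west order, so residues play no
role here. -/
theorem below_conj_iff_of_removable (hA : Removable s A)
    (hC : Removable s C) : Below C.conj A.conj ↔ Below A C := by
  simp only [Below, Node.conj, Fin.rev_lt_rev, Fin.rev_inj]
  refine or_congr Iff.rfl ⟨?_, ?_⟩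
  · rintro ⟨hc, h⟩
    refine ⟨hc.symm, lt_of_not_ge fun h' => ?_⟩
    exact (hC.2 A ⟨hA.1, by rintro rfl; exact h.ne rfl⟩ C hc h' h.le).2 rfl
  · rintro ⟨hc, h⟩
    refine ⟨hc.symm, lt_of_not_ge fun h' => ?_⟩
    exact (hA.2 C ⟨hC.1, by rintro rfl; exact h.ne rfl⟩ A hc h.le h').2 rfl

theorem Below.ne {A B : Node l} (h : Below A B) : B ≠ A := by
  rintro rfl
  rcases h with h | h
  · exact h.ne rfl
  · exact h.2.ne rfl

theorem dAbove_conj {κ' : Fin l → ZMod e} (hκ : ∀ A : Node l, res κ' A.conj = -res κ A)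
    (he : e ≠ 1) (hs : IsDiagram s) (hA : Removable s A) :
    dAbove κ' (Node.conj ⁻¹' (s \ {A})) A.conj = dBelow κ s A := by
  -- Conjugation is a bijection on all nodes, so the sets of nodes may be pulled back before they
  -- are compared.
  have hpre : ∀ t : Set (Node l), (Node.conj ⁻¹' t).ncard = t.ncard := fun t =>
    Set.ncard_preimage_of_injective_subset_range Node.conj_injective
      fun B _ => ⟨B.conj, B.conj_conj⟩
  unfold dAbove dBelow
  congr 2
  · rw [← hpre]
    congr 1
    ext C
    simp only [Set.mem_preimage, Set.mem_ofPred_eq, addable_conj_iff, hκ, neg_inj]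
    constructor
    · rintro ⟨h1, h2, h3⟩
      have h3' := h3.ne
      -- The node `A` becomes addable once deleted, but it is not strictly above itself and is not
      -- counted.
      have hne : C ≠ A := fun h => h3' (by rw [h])
      rw [addable_sdiff_iff he hs hA h2 hne] at h1
      exact ⟨h1, h2, (below_conj_iff_of_addable he hs hA h1 h2).1 h3⟩
    · rintro ⟨h1, h2, h3⟩
      exact ⟨(addable_sdiff_iff he hs hA h2 h3.ne).2 h1, h2,
        (below_conj_iff_of_addable he hs hA h1 h2).2 h3⟩
  · rw [← hpre]
    congr 1
    ext C
    simp only [Set.mem_preimage, Set.mem_ofPred_eq, removable_conj_iff, hκ, neg_inj]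
    constructor
    · rintro ⟨h1, h2, h3⟩
      have h3' := h3.ne
      have hne : C ≠ A := fun h => h3' (by rw [h])
      rw [removable_sdiff_iff he hs hA h2 hne] at h1
      exact ⟨h1, h2, (below_conj_iff_of_removable hA h1).1 h3⟩
    · rintro ⟨h1, h2, h3⟩
      exact ⟨(removable_sdiff_iff he hs hA h2 h3.ne).2 h1, h2,
        (below_conj_iff_of_removable hA h1).2 h3⟩

/-- The equality holds summand by summand. Monotonicity of `T` makes the shape of every initial
segment a diagram from which the last node is removable. -/
theorem codeg_conj {κ' : Fin l → ZMod e} (hκ : ∀ A : Node l, res κ' A.conj = -res κ A)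
    (he : e ≠ 1) {μ μ' : Fin l → YoungDiagram}
    {hμ : ∀ A : Node l, A.conj ∈ nodes μ' ↔ A ∈ nodes μ} {T : Tab d μ} {T' : Tab d μ'}
    (hT : TabConj hμ T T')
    (hmono : ∀ A B : {A // A ∈ nodes μ}, B.1.comp = A.1.comp → B.1.row ≤ A.1.row →
      B.1.col ≤ A.1.col → T B ≤ T A) :
    codeg κ' T' = deg κ T := by
  refine Finset.sum_congr rfl fun r _ => ?_
  have hmem : ∀ A ∈ nodes μ, ∀ B : Node l, B.comp = A.comp → B.row ≤ A.row → B.col ≤ A.col →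
      B ∈ nodes μ := by
    intro A hA B hc hrow hcol
    rw [mem_nodes] at hA ⊢
    rw [hc]
    exact (μ A.comp).up_left_mem hrow hcol hA
  have hs : IsDiagram {B | ∃ h : B ∈ nodes μ, T ⟨B, h⟩ ≤ r} := by
    rintro A ⟨hA, hr⟩ B hc hrow hcol
    exact ⟨hmem A hA B hc hrow hcol, (hmono ⟨A, hA⟩ ⟨B, _⟩ hc hrow hcol).trans hr⟩
  -- The degree uses the shape with the node of `r`, the codegree the shape without it; this set
  -- difference links the two conventions.
  have heq : {B | ∃ h : B ∈ nodes μ, T ⟨B, h⟩ ≤ r} \ {(T.symm r).1} =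
      {B | ∃ h : B ∈ nodes μ, T ⟨B, h⟩ < r} := by
    ext B
    constructor
    · rintro ⟨⟨hB, hr⟩, hne⟩
      refine ⟨hB, lt_of_le_of_ne hr ?_⟩
      rintro rfl
      simp at hne
    · rintro ⟨hB, hr⟩
      refine ⟨⟨hB, hr.le⟩, ?_⟩
      rintro rfl
      simp at hr
  have hA : Removable {B | ∃ h : B ∈ nodes μ, T ⟨B, h⟩ ≤ r} (T.symm r).1 := by
    refine ⟨⟨(T.symm r).2, by simp⟩, ?_⟩
    rw [heq]
    rintro A ⟨hA, hr⟩ B hc hrow hcol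
    exact ⟨hmem A hA B hc hrow hcol, (hmono ⟨A, hA⟩ ⟨B, _⟩ hc hrow hcol).trans_lt hr⟩
  rw [← dAbove_conj hκ he hs hA, heq, hT.symm_apply]
  congr 1
  ext B
  constructor
  · rintro ⟨hB, hr⟩
    refine ⟨(conj_mem_symm hμ B).2 hB, ?_⟩
    rw [← hT]
    convert hr
    exact B.conj_conj
  · rintro ⟨hB, hr⟩
    refine ⟨(conj_mem_symm hμ B).1 hB, ?_⟩
    rw [← hT] at hr
    convert hr
    exact B.conj_conj.symm

end Degree

/-! ### Conjugation of belts -/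

/-- Conjugation of nodes as an embedding. -/
def conjEmb (l : ℕ) : Node l ↪ Node l := ⟨Node.conj, Node.conj_injective⟩

theorem mem_map_conjEmb {l : ℕ} {s : Finset (Node l)} {B : Node l} :
    B ∈ s.map (conjEmb l) ↔ B.conj ∈ s := by
  rw [Finset.mem_map]
  constructor
  · rintro ⟨C, hC, rfl⟩
    change C.conj.conj ∈ s
    rwa [Node.conj_conj]
  · exact fun h => ⟨_, h, B.conj_conj⟩

/-- The belt whose nodes are conjugate to those of `b`. -/
def Belt.conj {l : ℕ} (b : Belt l) : Belt l where
  first := b.first.map (conjEmb l)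
  second := b.second.map (conjEmb l)
  bricks := b.bricks.map (Finset.mapEmbedding (conjEmb l)).toEmbedding

section Belt

variable {e l d : ℕ}

theorem colBrick_conj (H : Node l) : colBrick e H.conj = (rowBrick e H).map (conjEmb l) := by
  ext B
  simp only [colBrick, rowBrick, Finset.mem_map, Finset.mem_image, exists_exists_and_eq_and]
  rfl

theorem Belt.k_conj (b : Belt l) : b.conj.k = b.k := Finset.card_map _

theorem Belt.f_conj (b : Belt l) : b.conj.f = b.f := by
  classical
  refine Eq.trans ?_ (Finset.card_map (Finset.mapEmbedding (conjEmb l)).toEmbedding)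
  refine congrArg Finset.card (Finset.ext fun x => ?_)
  rw [Finset.mem_filter, Finset.mem_map]
  constructor
  · rintro ⟨hxb, hx⟩
    obtain ⟨y, hy, rfl⟩ := Finset.mem_map.1 hxb
    exact ⟨y, Finset.mem_filter.2 ⟨hy, Finset.map_subset_map.1 hx⟩, rfl⟩
  · rintro ⟨y, hy, rfl⟩
    obtain ⟨hy, hx⟩ := Finset.mem_filter.1 hy
    exact ⟨Finset.mem_map_of_mem _ hy, Finset.map_subset_map.2 hx⟩

theorem Belt.mem_first_conj (b : Belt l) (B : Node l) :
    B.conj ∈ b.conj.first ↔ B ∈ b.first := by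
  rw [Belt.conj, mem_map_conjEmb, Node.conj_conj]

theorem Belt.mem_second_conj (b : Belt l) (B : Node l) :
    B.conj ∈ b.conj.second ↔ B ∈ b.second := by
  rw [Belt.conj, mem_map_conjEmb, Node.conj_conj]

theorem Belt.inBrick_conj (b : Belt l) (B : Node l) : b.conj.InBrick B.conj ↔ b.InBrick B := by
  simp only [Belt.InBrick, Belt.conj, Finset.mem_map]
  constructor
  · rintro ⟨_, ⟨x, hx, rfl⟩, hB⟩
    refine ⟨x, hx, ?_⟩
    have := mem_map_conjEmb.1 hB
    rwa [Node.conj_conj] at this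
  · rintro ⟨x, hx, hB⟩
    refine ⟨_, ⟨x, hx, rfl⟩, mem_map_conjEmb.2 ?_⟩
    rwa [Node.conj_conj]

section Shape

variable {κ κ' : Fin l → ZMod e} {μ μ' : Fin l → YoungDiagram}

theorem colBelt_conj (hμ : ∀ A : Node l, A.conj ∈ nodes μ' ↔ A ∈ nodes μ)
    (hκ : ∀ A : Node l, res κ' A.conj = -res κ A) (A : Node l) :
    colBelt κ' μ' A.conj = (rowBelt κ μ A).conj := by
  classical
  have h1 : (colBelt κ' μ' A.conj).first = (rowBelt κ μ A).conj.first := by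
    ext B
    rw [← B.conj_conj, Belt.mem_first_conj]
    simp only [colBelt, rowBelt, Finset.mem_filter, hμ]
    simp [Node.conj, Fin.rev_eq_iff]
  have h2 : (colBelt κ' μ' A.conj).second = (rowBelt κ μ A).conj.second := by
    ext B
    rw [← B.conj_conj, Belt.mem_second_conj]
    simp only [colBelt, rowBelt, Finset.mem_filter, hμ]
    simp [Node.conj, Fin.rev_eq_iff]
  have h3 : (colBelt κ' μ' A.conj).bricks = (rowBelt κ μ A).conj.bricks := by
    have hsub : ∀ H : Node l,
        colBrick e H.conj ⊆ (colBelt κ' μ' A.conj).first ∪ (colBelt κ' μ' A.conj).second ↔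
          rowBrick e H ⊆ (rowBelt κ μ A).first ∪ (rowBelt κ μ A).second := by
      intro H
      rw [h1, h2, colBrick_conj, Belt.conj, ← Finset.map_union, Finset.map_subset_map]
    ext x
    constructor
    · intro hx
      obtain ⟨H, hH, rfl⟩ := Finset.mem_image.1 hx
      obtain ⟨hH, he, hres, hb⟩ := Finset.mem_filter.1 hH
      rw [← H.conj_conj] at hH hres hb ⊢
      rw [hκ, hκ, neg_inj] at hres
      refine Finset.mem_map.2 ⟨rowBrick e H.conj, Finset.mem_image.2 ⟨H.conj,
        Finset.mem_filter.2 ⟨(hμ _).1 hH, he, hres, (hsub _).1 hb⟩, rfl⟩, ?_⟩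
      exact (colBrick_conj _).symm
    · intro hx
      obtain ⟨_, hy, rfl⟩ := Finset.mem_map.1 hx
      obtain ⟨H, hH, rfl⟩ := Finset.mem_image.1 hy
      obtain ⟨hH, he, hres, hb⟩ := Finset.mem_filter.1 hH
      refine Finset.mem_image.2 ⟨H.conj, Finset.mem_filter.2
        ⟨(hμ _).2 hH, he, by rw [hκ, hκ, hres], (hsub _).2 hb⟩, ?_⟩
      exact colBrick_conj _
  exact (Belt.mk.injEq ..).mpr ⟨h1, h2, h3⟩

theorem Belt.conj_conj (b : Belt l) : b.conj.conj = b := by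
  have h : (conjEmb l).trans (conjEmb l) = Function.Embedding.refl _ :=
    Function.Embedding.ext Node.conj_conj
  have h' : (Finset.mapEmbedding (conjEmb l)).toEmbedding.trans
      (Finset.mapEmbedding (conjEmb l)).toEmbedding = Function.Embedding.refl _ := by
    refine Function.Embedding.ext fun x => ?_
    change (x.map _).map _ = x
    rw [Finset.map_map, h, Finset.map_refl]
  simp only [Belt.conj, Finset.map_map, h, h', Finset.map_refl]

/-- The case of column belts, read from the conjugate diagram, suffices because conjugation is an
involution. -/
theorem rowBelt_conj (hμ : ∀ A : Node l, A.conj ∈ nodes μ' ↔ A ∈ nodes μ)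
    (hκ : ∀ A : Node l, res κ' A.conj = -res κ A) (A : Node l) :
    rowBelt κ' μ' A.conj = (colBelt κ μ A).conj := by
  have := colBelt_conj (conj_mem_symm hμ) (res_conj_symm hκ) A.conj
  rw [Node.conj_conj] at this
  rw [this, Belt.conj_conj]

end Shape

section TabConj

variable {μ μ' : Fin l → YoungDiagram} {hμ : ∀ A : Node l, A.conj ∈ nodes μ' ↔ A ∈ nodes μ}
  {T : Tab d μ} {T' : Tab d μ'}

theorem Belt.before_conj (hT : TabConj hμ T T') (b : Belt l) (B : {A // A ∈ nodes μ}) :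
    b.conj.Before T' (conjEquiv hμ B) ↔ b.Before T B := by
  unfold Belt.Before
  rw [← (conjEquiv hμ).forall_congr_right]
  refine forall_congr' fun C => ?_
  rw [hT, hT]
  exact imp_congr_left (or_congr (b.mem_first_conj C.1) (b.mem_second_conj C.1))

theorem TabConj.garnirTab (hT : TabConj hμ T T') (b : Belt l) :
    TabConj hμ (b.garnirTab T) (b.conj.garnirTab T') := by
  classical
  refine hT.reorder fun B => ?_
  exact if_congr (b.mem_second_conj B.1) rfl
    (if_congr (b.mem_first_conj B.1) rfl (if_congr (b.before_conj hT B) rfl rfl))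

theorem TabConj.topTab (hT : TabConj hμ T T') (b : Belt l) :
    TabConj hμ (b.topTab T) (b.conj.topTab T') := by
  classical
  refine hT.reorder fun B => ?_
  have hi := b.inBrick_conj B.1
  exact if_congr (b.mem_second_conj B.1) (if_congr hi rfl rfl)
    (if_congr (b.mem_first_conj B.1) (if_congr hi rfl rfl) (if_congr (b.before_conj hT B) rfl rfl))

theorem Belt.n_conj (hT : TabConj hμ T T') (b : Belt l) : b.conj.n T' = b.n T := by
  unfold Belt.n
  congr 1
  ext t
  change (∃ B, _) ↔ (∃ B, _)
  rw [← (conjEquiv hμ).exists_congr_right]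
  refine exists_congr fun B => ?_
  rw [hT.garnirTab b B]
  exact and_congr_left fun _ => b.inBrick_conj B.1

end TabConj

/-! ### The bricks fill consecutive entries -/

/-- The bricks contain $ke$ distinct nodes, whose entries in the Garnir tableau are distinct and lie
between $n$ and $d-1$. The bound keeps the letters moved by the brick transpositions within range.
-/
theorem Belt.n_add_le {μ : Fin l → YoungDiagram} (T : Tab d μ) (b : Belt l) (he : 0 < e)
    (hk : 0 < b.k) (hcard : ∀ x ∈ b.bricks, x.card = e) (hsub : ∀ x ∈ b.bricks, x ⊆ nodes μ)
    (hdisj : ∀ x ∈ b.bricks, ∀ y ∈ b.bricks, x ≠ y → Disjoint x y) :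
    b.n T + b.k * e ≤ d := by
  classical
  have h1 : (b.bricks.biUnion id).card = b.k * e := by
    exact (Finset.card_biUnion hdisj).trans (Finset.sum_const_nat hcard)
  have h2 : (b.bricks.biUnion id).card ≤ (Finset.Ico (b.n T) d).card := by
    refine Finset.card_le_card_of_injOn
      -- The default value is never taken, since bricks consist of nodes of `μ`.
      (fun B => if h : B ∈ nodes μ then (b.garnirTab T ⟨B, h⟩ : ℕ) else 0) ?_ ?_
    · intro B hB
      obtain ⟨x, hx, hBx⟩ := Finset.mem_biUnion.1 hB
      have hBμ : B ∈ nodes μ := hsub x hx hBx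
      simp only [hBμ, dif_pos, Finset.coe_Ico, Set.mem_Ico, Fin.is_lt, and_true]
      exact Nat.sInf_le ⟨⟨B, hBμ⟩, ⟨x, hx, hBx⟩, rfl⟩
    · intro B hB C hC hBC
      obtain ⟨x, hx, hBx⟩ := Finset.mem_biUnion.1 hB
      obtain ⟨y, hy, hCy⟩ := Finset.mem_biUnion.1 hC
      have hBμ : B ∈ nodes μ := hsub x hx hBx
      have hCμ : C ∈ nodes μ := hsub y hy hCy
      simp only [hBμ, hCμ, dif_pos] at hBC
      exact congrArg Subtype.val ((b.garnirTab T).injective (Fin.ext hBC))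
  rw [h1, Nat.card_Ico] at h2
  -- Positivity shows that the subtraction `d - n` is not truncated.
  have := Nat.mul_pos hk he
  omega

theorem rowBelt_n_add_le (κ : Fin l → ZMod e) {μ : Fin l → YoungDiagram} (T : Tab d μ)
    (A : Node l) (hk : 0 < (rowBelt κ μ A).k) :
    (rowBelt κ μ A).n T + (rowBelt κ μ A).k * e ≤ d := by
  classical
  have hbrick : ∀ x ∈ (rowBelt κ μ A).bricks, ∃ H : Node l, 0 < e ∧ res κ H = res κ A ∧
      rowBrick e H ⊆ (rowBelt κ μ A).first ∪ (rowBelt κ μ A).second ∧ x = rowBrick e H := by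
    intro x hx
    obtain ⟨H, hH, rfl⟩ := Finset.mem_image.1 hx
    obtain ⟨_, he, hres, hb⟩ := Finset.mem_filter.1 hH
    exact ⟨H, he, hres, hb, rfl⟩
  obtain ⟨x, hx⟩ := Finset.card_pos.1 hk
  obtain ⟨-, he, -⟩ := hbrick x hx
  refine Belt.n_add_le T _ he hk ?_ ?_ ?_
  · intro x hx
    obtain ⟨H, -, -, -, rfl⟩ := hbrick x hx
    rw [rowBrick, Finset.card_image_of_injective, Finset.card_range]
    intro i j hij
    simpa using hij
  · intro x hx
    obtain ⟨H, -, -, hb, rfl⟩ := hbrick x hx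
    refine hb.trans (Finset.union_subset ?_ ?_) <;> exact Finset.filter_subset _ _
  · intro x hx y hy hxy
    obtain ⟨H, -, hH, -, rfl⟩ := hbrick x hx
    obtain ⟨H', -, hH', -, rfl⟩ := hbrick y hy
    rw [Finset.disjoint_left]
    intro B hB hB'
    apply hxy
    obtain ⟨i, hi, rfl⟩ := Finset.mem_image.1 hB
    obtain ⟨j, hj, hij⟩ := Finset.mem_image.1 hB'
    simp only [Node.mk.injEq, Finset.mem_range] at hij hi hj
    obtain ⟨hrow, hcol, hcomp⟩ := hij
    -- Overlapping bricks lie in one row, and their first nodes have equal residues. Their first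
    -- columns are thus congruent modulo $e$, and so are the two offsets, which are less than $e$
    -- and hence equal.
    have hres : (H'.col : ZMod e) = H.col := by
      rw [← hH', res, res, hrow, hcomp] at hH
      linear_combination -hH
    have hmod : j ≡ i [MOD e] := by
      rw [ZMod.natCast_eq_natCast_iff] at hres
      have := congrArg (· % e) hcol
      exact Nat.ModEq.add_left_cancel hres this
    have : j = i := Nat.ModEq.eq_of_lt_of_lt hmod hj hi
    subst this
    rw [show H = H' from Node.ext hrow.symm (by omega) hcomp.symm]

end Belt

/-! ### Signs -/

section Sign

variable (O : Type*) [CommRing O] {e l d : ℕ} {α β : QPlus e}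

theorem sign_simple (r : Fin (d - 1)) : Equiv.Perm.sign (simple r) = -1 :=
  Equiv.Perm.sign_swap fun h => by simpa [lo, hi] using congrArg Fin.val h

theorem sign_prod_simple (L : List (Fin (d - 1))) :
    Equiv.Perm.sign (L.map simple).prod = (-1) ^ L.length := by
  induction L with
  | nil => simp
  | cons r L ih => rw [List.map_cons, List.prod_cons, map_mul, ih, sign_simple, List.length_cons,
      pow_succ']

theorem sign_blockSwap {n k r : ℕ} (hn : n + k * e ≤ d) (hr : r + 1 < k) :
    Equiv.Perm.sign (blockSwap d e n r) = (-1) ^ e := by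
  have hk : (r + 2) * e ≤ k * e := Nat.mul_le_mul_right e hr
  rw [blockSwap, map_list_prod, List.map_map]
  have : (List.range e).map (Equiv.Perm.sign ∘ fun q => transp d (n + r * e + q) (n + r * e + q + e))
      = (List.range e).map fun _ => (-1 : ℤˣ) := by
    refine List.map_congr_left fun q hq => ?_
    rw [List.mem_range] at hq
    -- Both letters must be in range, as `transp` is the identity otherwise and would spoil the
    -- parity.
    have h : n + r * e + q < d ∧ n + r * e + q + e < d := by
      constructor <;> linarith
    rw [Function.comp_apply, transp, dif_pos h]
    refine Equiv.Perm.sign_swap fun h' => ?_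
    have := congrArg Fin.val h'
    simp only at this
    omega
  rw [this, List.map_const', List.prod_replicate, List.length_range]

theorem sgnHom_prod_psi (h : β = α.neg) (L : List (Fin (d - 1))) :
    sgnHom O h (L.map (psi O)).prod = (-1 : O) ^ L.length • (L.map (psi O)).prod := by
  induction L with
  | nil => simp
  | cons r L ih =>
    rw [List.map_cons, List.prod_cons, map_mul, ih, sgnHom_psi, List.map_cons, List.prod_cons,
      List.length_cons, pow_succ, mul_smul, neg_smul, one_smul, mul_smul_comm, neg_mul]

/-- Both algebras use the same word for `w`, and the parity of its length is given by the sign of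
`w`. -/
theorem sgnHom_psiPerm (h : β = α.neg) (c : Preferred) (w : Equiv.Perm (Fin d)) :
    sgnHom O h (psiPerm O c w) = ((Equiv.Perm.sign w : ℤ) : O) • psiPerm O c w := by
  rw [psiPerm, sgnHom_prod_psi, psiPerm]
  congr 1
  conv_rhs => rw [← (c.isReduced w).1, sign_prod_simple]
  push_cast
  rfl

/-! ### Garnir elements under the sign isomorphism -/

section Garnir

variable (c : Preferred) {κ κ' : Fin l → ZMod e} (μ : Par κ α) (μ' : Par κ' β) (h : β = α.neg)
  (hκ : ∀ A : Node l, res κ' A.conj = -res κ A)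
  {hμ : ∀ A : Node l, A.conj ∈ nodes μ'.1 ↔ A ∈ nodes μ.1}
  {T : Tab d μ.1} {T' : Tab d μ'.1} (hT : TabConj hμ T T') (ε : O) (b : Belt l)
  (hb : 0 < b.k → b.n T + b.k * e ≤ d)

include hκ hT hb

theorem sgnHom_tau (r : Fin (b.k - 1)) (r' : Fin (b.conj.k - 1)) (hr : (r' : ℕ) = r) :
    sgnHom O h (tau O c ε μ T b r) = tau O c (ε * (-1) ^ e) μ' T' b.conj r' := by
  have hr1 := r.2
  have hi : resSeq μ' (b.conj.garnirTab T') = (resSeq μ (b.garnirTab T)).neg h :=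
    resSeq_conj μ μ' h hκ (hT.garnirTab b)
  have hs : Equiv.Perm.sign (blockSwap d e (b.n T) r) = (-1) ^ e :=
    sign_blockSwap (k := b.k) (hb (by omega)) (by omega)
  simp only [tau, hi, hr, b.n_conj hT, map_mul, map_add, map_smul, map_one, sgnHom_idem,
    sgnHom_psiPerm, hs]
  push_cast
  rw [smul_mul_assoc, mul_smul]

/-- The factors $\tau_u$ go to their counterparts without any further sign, so the only scalar is
the sign of the permutation leading to the extremal tableau. The coefficient `ε` is left free in
order to cover rows and columns at once. -/
theorem sgnHom_garnir :
    sgnHom O h (garnir O c ε μ T b) =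
      ((Equiv.Perm.sign (permTo T (b.topTab T)) : ℤ) : O) •
        garnir O c (ε * (-1) ^ e) μ' T' b.conj := by
  -- The brick numbers of a belt and its conjugate are equal but not definitionally so, and they
  -- occur in types; with variables in their place the equalities can be substituted.
  have key : ∀ {k k' f f' : ℕ} (τ : Fin (k - 1) → Alg O d α) (τ' : Fin (k' - 1) → Alg O d β)
      (a : Alg O d β), k' = k → f' = f →
      (∀ (r : Fin (k - 1)) (r' : Fin (k' - 1)), (r' : ℕ) = r → sgnHom O h (τ r) = τ' r') →
      ∑ u ∈ cosetReps k f, sgnHom O h ((c.word u).map τ).prod * a =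
        ∑ u ∈ cosetReps k' f', ((c.word u).map τ').prod * a := by
    rintro k _ f _ τ τ' a rfl rfl hτ
    refine Finset.sum_congr rfl fun u _ => ?_
    rw [map_list_prod, List.map_map]
    congr 3
    exact funext fun r => hτ r r rfl
  simp only [garnir, map_sum, map_mul, sgnHom_psiPerm]
  rw [key _ (tau O c (ε * (-1) ^ e) μ' T' b.conj) _ b.k_conj b.f_conj
    (sgnHom_tau O c μ μ' h hκ hT ε b hb), hT.permTo (hT.topTab b)]
  simp only [mul_smul_comm, Finset.smul_sum]

end Garnir

end Sign

/-! ### The sign isomorphism respects gradings and relations -/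

section Main

variable (O : Type*) [CommRing O] {e l d : ℕ} {α β : QPlus e}

theorem cartan_neg (i j : ZMod e) : cartan (-i) (-j) = cartan i j := by
  classical
  exact if_congr neg_inj rfl (if_congr (by rw [arrow_neg, arrow_neg, and_comm]) rfl
    (if_congr (by rw [arrow_neg, arrow_neg, or_comm]) rfl rfl))

/-- Products of generators are sent to such products up to a sign, which `HomProd` does not absorb
but the spanned submodule does. -/
theorem HomProd.sgnHom (h : β = α.neg) {n : ℤ} {a : Alg O d α} (ha : HomProd O n a) :
    HomProd O n (sgnHom O h a) ∨ HomProd O n (-sgnHom O h a) := by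
  induction ha with
  | e i => exact Or.inl (by rw [sgnHom_idem]; exact .e _)
  | y r => exact Or.inr (by rw [sgnHom_y, neg_neg]; exact .y _)
  | psi r i =>
    refine Or.inr ?_
    rw [map_mul, sgnHom_psi, sgnHom_idem, neg_mul, neg_neg, ← cartan_neg]
    exact .psi r (i.neg h)
  | mul _ _ iha ihb =>
    rw [map_mul]
    rcases iha with iha | iha <;> rcases ihb with ihb | ihb
    · exact Or.inl (iha.mul ihb)
    · exact Or.inr (by simpa using iha.mul ihb)
    · exact Or.inr (by simpa using iha.mul ihb)
    · exact Or.inl (by simpa using iha.mul ihb)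

theorem sgnHom_mem_algDeg (h : β = α.neg) {n : ℤ} {a : Alg O d α} (ha : a ∈ algDeg O d α n) :
    sgnHom O h a ∈ algDeg O d β n := by
  suffices algDeg O d α n ≤ (algDeg O d β n).comap (sgnHom O h).toLinearMap from this ha
  refine Submodule.span_le.2 fun a ha => ?_
  change sgnHom O h a ∈ algDeg O d β n
  rcases HomProd.sgnHom O h ha with h' | h'
  · exact Submodule.subset_span h'
  · exact neg_mem_iff.1 (Submodule.subset_span h' : -sgnHom O h a ∈ algDeg O d β n)

variable (c : Preferred) {κ κ' : Fin l → ZMod e} (hd : ht α = d) (hd' : ht β = d)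
  (μ : Par κ α) (μ' : Par κ' β)

open Classical in
-- Each generator of the left ideal goes to a scalar multiple of a generator. Keeping the tableaux,
-- the adjacency conditions and the Garnir elements abstract serves both directions, rows to columns
-- and columns to rows.
theorem sgnHom_mem_span (h : β = α.neg) (hκ : ∀ A : Node l, res κ' A.conj = -res κ A)
    {hμ : ∀ A : Node l, A.conj ∈ nodes μ'.1 ↔ A ∈ nodes μ.1} {T : Tab d μ.1} {T' : Tab d μ'.1}
    (hT : TabConj hμ T T') {P P' : Fin (d - 1) → Prop} (hP : ∀ r, P r → P' r)
    {Q Q' : Node l → Prop} (hQ : ∀ A, Q A → Q' A.conj)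
    {G : Node l → Alg O d α} {G' : Node l → Alg O d β}
    (hG : ∀ A, ∃ a : O, sgnHom O h (G A) = a • G' A.conj) {x : Alg O d α}
    (hx : x ∈ Submodule.span (Alg O d α)
      ({x | ∃ j : Seq d α, x = idem O j - if j = resSeq μ T then 1 else 0} ∪
       {x | ∃ r : Fin d, x = y O r} ∪
       {x | ∃ r : Fin (d - 1), P r ∧ x = psi O r} ∪
       {x | ∃ A : Node l, Q A ∧ x = G A})) :
    sgnHom O h x ∈ Submodule.span (Alg O d β)
      ({x | ∃ j : Seq d β, x = idem O j - if j = resSeq μ' T' then 1 else 0} ∪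
       {x | ∃ r : Fin d, x = y O r} ∪
       {x | ∃ r : Fin (d - 1), P' r ∧ x = psi O r} ∪
       {x | ∃ A : Node l, Q' A ∧ x = G' A}) := by
  induction hx using Submodule.span_induction with
  | mem x hx =>
    rcases hx with ((⟨j, rfl⟩ | ⟨r, rfl⟩) | ⟨r, hr, rfl⟩) | ⟨A, hA, rfl⟩
    · refine Submodule.subset_span (Or.inl (Or.inl (Or.inl ⟨j.neg h, ?_⟩)))
      rw [map_sub, sgnHom_idem, resSeq_conj μ μ' h hκ hT, (Seq.neg_injective h).eq_iff]
      split_ifs <;> simp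
    · rw [sgnHom_y]
      exact neg_mem (Submodule.subset_span (Or.inl (Or.inl (Or.inr ⟨r, rfl⟩))))
    · rw [sgnHom_psi]
      exact neg_mem (Submodule.subset_span (Or.inl (Or.inr ⟨r, hP r hr, rfl⟩)))
    · obtain ⟨a, ha⟩ := hG A
      rw [ha, Algebra.smul_def]
      exact Submodule.smul_mem _ _ (Submodule.subset_span (Or.inr ⟨_, hQ A hA, rfl⟩))
  | zero => rw [map_zero]; exact zero_mem _
  | add x y _ _ hx hy => rw [map_add]; exact add_mem hx hy
  | smul a x _ hx => rw [smul_eq_mul, map_mul]; exact Submodule.smul_mem _ _ hx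

variable (h : β = α.neg) (hκ : ∀ A : Node l, res κ' A.conj = -res κ A)
  (hμ : ∀ A : Node l, A.conj ∈ nodes μ'.1 ↔ A ∈ nodes μ.1)

theorem isColGarnir_conj {μ μ' : Fin l → YoungDiagram}
    (hμ : ∀ A : Node l, A.conj ∈ nodes μ' ↔ A ∈ nodes μ) {A : Node l} (hA : IsRowGarnir μ A) :
    IsColGarnir μ' A.conj :=
  ⟨(hμ _).2 hA.1, (hμ _).2 hA.2⟩

theorem isRowGarnir_conj {μ μ' : Fin l → YoungDiagram}
    (hμ : ∀ A : Node l, A.conj ∈ nodes μ' ↔ A ∈ nodes μ) {A : Node l} (hA : IsColGarnir μ A) :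
    IsRowGarnir μ' A.conj :=
  ⟨(hμ _).2 hA.1, (hμ _).2 hA.2⟩

include hκ hμ

theorem sgnHom_mem_colIdeal {x : Alg O d α} (hx : x ∈ rowIdeal O c hd μ) :
    sgnHom O h x ∈ colIdeal O c hd' μ' := by
  have hT := tabConj_rowTab_colTab hd hd' μ μ' hμ
  refine sgnHom_mem_span O μ μ' h hκ hT (fun r => (hT.rowNext_iff r).2)
    (fun A => isColGarnir_conj hμ) (fun A => ?_) hx
  rw [rowGarnir, colGarnir, sgnHom_garnir O c μ μ' h hκ hT 1 _ (rowBelt_n_add_le κ _ A),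
    one_mul, colBelt_conj hμ hκ]
  exact ⟨_, rfl⟩

theorem sgnHom_mem_rowIdeal {x : Alg O d α} (hx : x ∈ colIdeal O c hd μ) :
    sgnHom O h x ∈ rowIdeal O c hd' μ' := by
  have hT : TabConj hμ (colTab hd μ) (rowTab hd' μ') :=
    (tabConj_rowTab_colTab hd' hd μ' μ (conj_mem_symm hμ)).symm
  refine sgnHom_mem_span O μ μ' h hκ hT (fun r => (hT.symm.rowNext_iff r).1)
    (fun A => isRowGarnir_conj hμ) (fun A => ?_) hx
  -- A column belt is conjugate to a row belt, so its bound is that of the row belt.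
  have hb : 0 < (colBelt κ μ.1 A).k →
      (colBelt κ μ.1 A).n (colTab hd μ) + (colBelt κ μ.1 A).k * e ≤ d := by
    rw [← Belt.n_conj hT, ← Belt.k_conj, ← rowBelt_conj hμ hκ]
    exact rowBelt_n_add_le κ' _ A.conj
  -- The coefficient becomes $(-1)^e(-1)^e=1$, as the row Garnir element requires.
  rw [rowGarnir, colGarnir, sgnHom_garnir O c μ μ' h hκ hT _ _ hb, ← mul_pow, neg_one_mul,
    neg_neg, one_pow, rowBelt_conj hμ hκ]
  exact ⟨_, rfl⟩

end Main

/-! ### Isomorphisms of twisted cyclic modules -/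

theorem gradedIso_of_ringEquiv {A B : Type*} [Ring A] [Ring B] (f : A ≃+* B)
    (I : Submodule A A) (J : Submodule B B) (hIJ : ∀ x, x ∈ I ↔ f x ∈ J)
    (P : ℤ → AddSubgroup A) (Q : ℤ → AddSubgroup B) (hPQ : ∀ n x, x ∈ P n ↔ f x ∈ Q n) :
    GradedIso (A := A) (fun n => (P n).map I.mkQ.toAddMonoidHom)
      (twistDeg f.toRingHom fun n => (Q n).map J.mkQ.toAddMonoidHom) := by
  let g : A →ₗ[A] Twist f.toRingHom (B ⧸ J) :=
    { toFun := fun x => J.mkQ (f x)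
      map_add' := fun x y => by rw [map_add, map_add]; rfl
      map_smul' := fun a x => by
        rw [smul_eq_mul, map_mul, ← smul_eq_mul, map_smul]; rfl }
  have hker : I = LinearMap.ker g := by
    ext x
    rw [hIJ, LinearMap.mem_ker]
    exact (Submodule.Quotient.mk_eq_zero J).symm
  have hsurj : Function.Surjective g := by
    intro z
    obtain ⟨b, rfl⟩ := J.mkQ_surjective z
    exact ⟨f.symm b, congrArg J.mkQ (f.apply_symm_apply b)⟩
  let φ : (A ⧸ I) ≃ₗ[A] Twist f.toRingHom (B ⧸ J) :=
    (Submodule.quotEquivOfEq _ _ hker).trans (g.quotKerEquivOfSurjective hsurj)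
  have hφ : ∀ x, φ (I.mkQ x) = J.mkQ (f x) := fun _ => rfl
  refine ⟨φ, fun n x => ⟨?_, ?_⟩⟩
  · rintro ⟨a, ha, rfl⟩
    exact ⟨f a, (hPQ n a).1 ha, rfl⟩
  · rintro ⟨b, hb, hx⟩
    -- A homogeneous representative of the image is pulled back along `f`; it represents `x` because
    -- `φ` is injective.
    refine ⟨f.symm b, (hPQ n _).2 (by rw [f.apply_symm_apply]; exact hb), φ.injective ?_⟩
    refine Eq.trans ?_ hx
    refine (hφ _).trans ?_
    rw [f.apply_symm_apply]
    rfl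

/-- The inverse of `sgn` is the sign map from $\alpha'$ back to $\alpha$, so two one-sided
inclusions give an equivalence. Since $\alpha''=\alpha$ is not a definitional equality, `sgnHom` is
stated for any `β` with a proof of `β = α.neg`. -/
theorem sgn_mem_iff (O : Type*) [CommRing O] {e d : ℕ} {α : QPlus e} {S : Alg O d α → Prop}
    {S' : Alg O d α.neg → Prop} (h : ∀ x, S x → S' (sgnHom O rfl x))
    (h' : ∀ x, S' x → S (sgnHom O (QPlus.neg_neg α).symm x)) (x : Alg O d α) :
    S x ↔ S' (sgn O d α x) := by
  refine ⟨h x, fun hx => ?_⟩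
  have := h' _ hx
  rwa [show sgnHom O (QPlus.neg_neg α).symm (sgn O d α x) = x from
    (sgn O d α).symm_apply_apply x] at this

end KLR

/-! ### The two isomorphisms -/

theorem mainTheorem8 (O : Type*) [CommRing O] (e : ℕ) (he : e ≠ 1) (l : ℕ) (hl : 0 < l)
    (κ : Fin l → ZMod e) (c : KLR.Preferred) (α : KLR.QPlus e) (d : ℕ) (hd : KLR.ht α = d)
    (μ : KLR.Par κ α) :
    KLR.GradedIso (A := KLR.Alg O d α)
        (KLR.rowDeg O c hd μ)
        (KLR.twistDeg (KLR.sgn O d α).toRingEquiv.toRingHom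
          (KLR.colDeg O c ((KLR.ht_neg α).trans hd) μ.conj)) ∧
      KLR.GradedIso (A := KLR.Alg O d α)
        (KLR.colDeg O c hd μ)
        (KLR.twistDeg (KLR.sgn O d α).toRingEquiv.toRingHom
          (KLR.rowDeg O c ((KLR.ht_neg α).trans hd) μ.conj)) := by
  have hd' := (KLR.ht_neg α).trans hd
  have hμ : ∀ A : KLR.Node l, A.conj ∈ KLR.nodes μ.conj.1 ↔ A ∈ KLR.nodes μ.1 :=
    fun _ => KLR.conj_mem_nodes
  have hκ : ∀ A : KLR.Node l, KLR.res (KLR.conjCharge κ) A.conj = -KLR.res κ A := KLR.res_conj κ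
  have hμ' := KLR.conj_mem_symm hμ
  have hκ' := KLR.res_conj_symm hκ
  have hneg := (KLR.QPlus.neg_neg α).symm
  have hdeg : ∀ n (x : KLR.Alg O d α),
      x ∈ KLR.algDeg O d α n ↔ KLR.sgn O d α x ∈ KLR.algDeg O d α.neg n := fun n =>
    KLR.sgn_mem_iff O (S := (· ∈ KLR.algDeg O d α n)) (S' := (· ∈ KLR.algDeg O d α.neg n))
      (fun _ h => KLR.sgnHom_mem_algDeg O rfl h) (fun _ h => KLR.sgnHom_mem_algDeg O hneg h)
  constructor
  · refine KLR.gradedIso_of_ringEquiv (KLR.sgn O d α).toRingEquiv _ _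
      (KLR.sgn_mem_iff O (S := (· ∈ KLR.rowIdeal O c hd μ)) (S' := (· ∈ KLR.colIdeal O c hd' μ.conj))
        (fun _ h => KLR.sgnHom_mem_colIdeal O c hd hd' μ μ.conj rfl hκ hμ h)
        (fun _ h => KLR.sgnHom_mem_rowIdeal O c hd' hd μ.conj μ hneg hκ' hμ' h)) _ _ fun n x => ?_
    -- The generators have equal degree, so both gradings are shifted by the same amount.
    rw [KLR.codeg_conj hκ he (KLR.tabConj_rowTab_colTab hd hd' μ μ.conj hμ)
      fun _ _ => KLR.rowTab_mono hd μ]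
    exact hdeg _ x
  · refine KLR.gradedIso_of_ringEquiv (KLR.sgn O d α).toRingEquiv _ _
      (KLR.sgn_mem_iff O (S := (· ∈ KLR.colIdeal O c hd μ)) (S' := (· ∈ KLR.rowIdeal O c hd' μ.conj))
        (fun _ h => KLR.sgnHom_mem_rowIdeal O c hd hd' μ μ.conj rfl hκ hμ h)
        (fun _ h => KLR.sgnHom_mem_colIdeal O c hd' hd μ.conj μ hneg hκ' hμ' h)) _ _ fun n x => ?_
    -- The equality of degrees is read from $\mu'$ to $\mu$, so that again only the monotonicity of
    -- a row tableau is needed.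
    rw [KLR.codeg_conj hκ' he (KLR.tabConj_rowTab_colTab hd' hd μ.conj μ hμ')
      fun _ _ => KLR.rowTab_mono hd' μ.conj]
    exact hdeg _ x
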